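/- Let $n,K\ge 0$ be integers. Let $\mathcal S$ be the product of $K$ copies of the manifold of real symmetric positive definite $n\times n$ matrices, an open subset of the space of $K$-tuples of symmetric matrices, and let $\mathcal M=\{x=(X_1,\dots,X_K)\in\mathcal S:\ X_1+\dots+X_K=I\}$, with tangent space $T_x\mathcal M=\{(\xi_1,\dots,\xi_K):\ \xi_i^\top=\xi_i,\ \sum_i\xi_i=0\}$ at every point. Equip both with the Riemannian metric $g_x(\xi,\eta)=\sum_i\operatorname{tr}(X_i^{-1}\xi_iX_i^{-1}\eta_i)$, and write $\operatorname{symm}(A)=(A+A^\top)/2$. For $x\in\mathcal M$ and a tuple $z=(Z_1,\dots,Z_K)$ of real $n\times n$ matrices, let $$\Pi_x(z)=\operatorname*{arg\,min}_{\xi\in T_x\mathcal M}\ -g_x(z,\xi)+\tfrac12 g_x(\xi,\xi).$$ (0) The minimiser $\Pi_x(z)$ exists and is unique. If all $Z_i$ are symmetric, there is exactly one symmetric matrix $\Lambda$ with $\sum_iX_i\Lambda X_i=-\sum_iZ_i$, and $\Pi_x(z)=(Z_i+X_i\Lambda X_i)_i$. (1) Gradient. Let $f$ be a real function that is smooth on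 $\mathcal S$. For $x\in\mathcal S$ let $\nabla_{X_i}f$ denote any matrix with $\frac{d}{dt}\big|_{t=0}f(X_1,\dots,X_i+tH,\dots,X_K)=\operatorname{tr}((\nabla_{X_i}f)^\top H)$ for all symmetric $H$; such matrices exist (if $f$ is differentiable as a function of all matrix entries, the matrix of its partial derivatives is one). The Riemannian gradient of $f$ on $\mathcal S$ is $(X_i\operatorname{symm}(\nabla_{X_i}f)X_i)_i$, and for $x\in\mathcal M$ the Riemannian gradient on $\mathcal M$ of the restriction of $f$ is $$\operatorname{grad}_xf=\Pi_x\big((X_i\operatorname{symm}(\nabla_{X_i}f)X_i)_i\big).$$ (2) Connection. The Levi-Civita connections $\nabla^{\mathcal S}$ of $\mathcal S$ and $\nabla$ of $\mathcal M$ (metric and torsion-free) exist and are smooth. For a vector field $\eta$ on $\mathcal S$ that is differentiable at $x$ and a tangent vector $\xi$ at $x$, $\nabla^{\mathcal S}_\xi\eta=\mathrm D\eta[\xi]-(\operatorname{symm}(\xi_iX_i^{-1}\eta_i))_i$. For a vector field $\eta$ on $\mathcal M$ that is differentiable at $x\in\mathcal M$ and $\xi\in T_x\mathcal M$, $$\nabla_\xi\eta=\Pi_x\big(\mathrm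 D\eta[\xi]-(\operatorname{symm}(\xi_iX_i^{-1}\eta_i))_i\big),$$ where $\mathrm D\eta[\xi]$ is the directional derivative of $\eta$ as a matrix-tuple-valued map; moreover $\nabla_\xi\eta=\Pi_x(\nabla^{\mathcal S}_\xi\tilde\eta)$ for every vector field $\tilde\eta$ on $\mathcal S$ that extends $\eta$ and is differentiable at $x$. (3) Hessian. Let $f$ be as in (1) and $x\in\mathcal M$. There is exactly one linear operator $\operatorname{Hess}_xf$ on $T_x\mathcal M$ with $g_x(\operatorname{Hess}_xf[\xi],Y_x)=\xi(Yf)-(\nabla_\xi Y)f$ for all $\xi\in T_x\mathcal M$ and all smooth vector fields $Y$ on $\mathcal M$, and for every $\xi\in T_x\mathcal M$ $$\operatorname{Hess}_xf[\xi]=\nabla_\xi\operatorname{grad}f=\Pi_x\big(\mathrm D(\operatorname{grad}f)[\xi]-(\operatorname{symm}(\xi_iX_i^{-1}(\operatorname{grad}_xf)_i))_i\big).$$ -/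

import Mathlib

open Topology
open scoped Manifold ContDiff Matrix

noncomputable section

/-- A linear subspace `V` of a normed space, as a normed space in its own right. -/
def Direction {E : Type} [NormedAddCommGroup E] [NormedSpace ℝ E] (V : Submodule ℝ E) : Type := V

namespace Direction
variable {E : Type} [NormedAddCommGroup E] [NormedSpace ℝ E] (V : Submodule ℝ E)

instance : NormedAddCommGroup (Direction V) := inferInstanceAs (NormedAddCommGroup V)
instance : NormedSpace ℝ (Direction V) := inferInstanceAs (NormedSpace ℝ V)
instance [FiniteDimensional ℝ E] : FiniteDimensional ℝ (Direction V) :=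
  inferInstanceAs (FiniteDimensional ℝ V)
instance [FiniteDimensional ℝ E] : CompleteSpace (Direction V) := FiniteDimensional.complete ℝ _

/-- The inclusion of the subspace `V`. -/
def incl : Direction V →L[ℝ] E := V.subtypeL

/-- A vector of `V`. -/
def mk (v : E) (hv : v ∈ V) : Direction V := (⟨v, hv⟩ : V)

@[simp] theorem incl_mk (v : E) (hv : v ∈ V) : incl V (mk V v hv) = v := rfl

theorem incl_mem (v : Direction V) : incl V v ∈ V := Subtype.property (p := (· ∈ V)) v

theorem incl_injective : Function.Injective (incl V) :=
  fun _ _ h => Subtype.ext (p := (· ∈ V)) h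

theorem isInducing_incl : IsInducing (incl V) := IsInducing.subtypeVal

end Direction

open Direction

/-- The set `s` is a relatively open subset of the affine subspace `base + V`.  Such a set is a
smooth manifold modelled on `V`, an open subset of an affine space. -/
class AffineOpen {E : Type} [NormedAddCommGroup E] [NormedSpace ℝ E]
    (s : Set E) (V : Submodule ℝ E) where
  base (V) : E
  sub_mem (V) : ∀ x ∈ s, x - base ∈ V
  isOpen_preimage : IsOpen {v : Direction V | base + incl V v ∈ s}

namespace AffineOpen
variable {E : Type} [NormedAddCommGroup E] [NormedSpace ℝ E]
variable (s : Set E) (V : Submodule ℝ E) [AffineOpen s V]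

/-- The global coordinate `x ↦ x - base`. -/
def coord (x : s) : Direction V := Direction.mk V ((x : E) - base s V) (sub_mem V x x.2)

theorem base_add_incl_coord (x : s) : base s V + incl V (coord s V x) = x := by
  simp [coord]

theorem isOpenEmbedding_coord : IsOpenEmbedding (coord s V) := by
  have hc : Continuous (coord s V) := by
    rw [(isInducing_incl V).continuous_iff]
    have : incl V ∘ coord s V = fun x : s => (x : E) - base s V := rfl
    rw [this]
    fun_prop
  refine ⟨⟨?_, ?_⟩, ?_⟩
  · constructor
    apply le_antisymm
    · exact continuous_iff_le_induced.1 hc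
    · have h2 : (instTopologicalSpaceSubtype : TopologicalSpace s) =
          TopologicalSpace.induced (fun x : s => (x : E)) inferInstance := rfl
      rw [h2]
      have h3 : (fun x : s => (x : E)) = (fun v => base s V + incl V v) ∘ coord s V := by
        funext x; exact (base_add_incl_coord s V x).symm
      rw [h3, ← induced_compose]
      apply induced_mono
      rw [← continuous_iff_le_induced]
      fun_prop
  · intro x y h
    apply Subtype.ext
    rw [← base_add_incl_coord s V x, h, base_add_incl_coord s V y]
  · have : Set.range (coord s V) = {v : Direction V | base s V + incl V v ∈ s} := by
      ext v; constructor
      · rintro ⟨x, rfl⟩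
        change base s V + incl V (coord s V x) ∈ s
        rw [base_add_incl_coord]; exact x.2
      · intro hv
        refine ⟨⟨_, hv⟩, incl_injective V ?_⟩
        have := base_add_incl_coord s V ⟨_, hv⟩
        simpa using this
    rw [this]; exact isOpen_preimage

/-- The global chart `x ↦ x - base`. -/
def chart (h : Nonempty s) : OpenPartialHomeomorph s (Direction V) :=
  haveI := h
  (isOpenEmbedding_coord s V).toOpenPartialHomeomorph (coord s V)

instance chartedSpace : ChartedSpace (Direction V) s where
  atlas := {e | ∃ h : Nonempty s, e = chart s V h}
  chartAt x := chart s V ⟨x⟩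
  mem_chart_source _ := by simp [chart]
  chart_mem_atlas x := ⟨⟨x⟩, rfl⟩

instance isManifold (n : ℕ∞ω) : IsManifold 𝓘(ℝ, Direction V) n s := by
  by_cases h : Nonempty s
  · have : chartedSpace s V = (isOpenEmbedding_coord s V).singletonChartedSpace := by
      apply ChartedSpace.ext
      · ext e; constructor
        · rintro ⟨_, he⟩; exact he
        · intro he; exact ⟨h, he⟩
      · rfl
    rw [this]
    exact (isOpenEmbedding_coord s V).isManifold_singleton
  · have : HasGroupoid s (contDiffGroupoid n 𝓘(ℝ, Direction V)) :=
      ⟨by rintro _ _ ⟨h', _⟩; exact absurd h' h⟩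
    exact IsManifold.mk' _ _ _

theorem contMDiff_val (n : ℕ∞ω) :
    ContMDiff 𝓘(ℝ, Direction V) 𝓘(ℝ, E) n (Subtype.val : s → E) := by
  intro x
  have h1 : ContMDiffAt 𝓘(ℝ, Direction V) 𝓘(ℝ, Direction V) n
      (extChartAt 𝓘(ℝ, Direction V) x) x := contMDiffAt_extChartAt
  have h2 : ContDiff ℝ n (fun v : Direction V => base s V + incl V v) :=
    contDiff_const.add (incl V).contDiff
  have h3 := h2.contMDiff.contMDiffAt.comp x h1
  exact h3.congr_of_eventuallyEq
    (Filter.Eventually.of_forall fun y => (base_add_incl_coord s V y).symm)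

theorem tangentCoordChange_eq (x y z : s) :
    tangentCoordChange 𝓘(ℝ, Direction V) x y z = .id ℝ (Direction V) := by
  have : tangentCoordChange 𝓘(ℝ, Direction V) x y z =
    tangentCoordChange 𝓘(ℝ, Direction V) x x z := rfl
  rw [this]
  ext v
  rw [tangentCoordChange_self]; rfl
  simp [chartAt, ChartedSpace.chartAt, chart]

/-- The inclusion of the tangent space at `x` into the ambient vector space: the derivative at `x`
of the inclusion of `s` (see `mfderiv_val`). -/
def emb {s : Set E} {V : Submodule ℝ E} [AffineOpen s V] (x : s) :
    TangentSpace 𝓘(ℝ, Direction V) x →L[ℝ] E := incl V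

theorem mfderiv_val (x : s) :
    mvfderiv 𝓘(ℝ, Direction V) (Subtype.val : s → E) x = emb x := by
  have h0 : MDifferentiableAt 𝓘(ℝ, Direction V) 𝓘(ℝ, E) (Subtype.val : s → E) x :=
    (contMDiff_val s V 1).mdifferentiableAt one_ne_zero
  have : mfderiv 𝓘(ℝ, Direction V) 𝓘(ℝ, E) (Subtype.val : s → E) x = incl V := by
    rw [h0.mfderiv]
    have : HasFDerivAt (writtenInExtChartAt 𝓘(ℝ, Direction V) 𝓘(ℝ, E) x (Subtype.val : s → E))
        (incl V) (extChartAt 𝓘(ℝ, Direction V) x x) := by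
      have h2 : HasFDerivAt (fun v : Direction V => base s V + incl V v) (incl V)
        (extChartAt 𝓘(ℝ, Direction V) x x) := (incl V).hasFDerivAt.const_add _
      apply h2.congr_of_eventuallyEq
      filter_upwards [extChartAt_target_mem_nhds x] with v hv
      have h4 := (extChartAt 𝓘(ℝ, Direction V) x).right_inv hv
      have h5 : extChartAt 𝓘(ℝ, Direction V) x ((extChartAt 𝓘(ℝ, Direction V) x).symm v)
        = coord s V ((extChartAt 𝓘(ℝ, Direction V) x).symm v) := rfl
      rw [h5] at h4
      simp only [writtenInExtChartAt, extChartAt_model_space_eq_id, PartialEquiv.refl_coe,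
        Function.comp]
      conv_rhs => rw [← h4]
      exact (base_add_incl_coord s V _).symm
    simpa using! this.fderiv
  simp only [mvfderiv, emb]
  rw [this]
  rfl

theorem emb_mem {s : Set E} {V : Submodule ℝ E} [AffineOpen s V] (x : s)
    (ξ : TangentSpace 𝓘(ℝ, Direction V) x) : emb x ξ ∈ V := incl_mem V ξ

theorem emb_injective {s : Set E} {V : Submodule ℝ E} [AffineOpen s V] (x : s) :
    Function.Injective (emb (V := V) x) := incl_injective V

theorem isVonNBounded_of_pos [FiniteDimensional ℝ E] (B : Direction V →L[ℝ] Direction V →L[ℝ] ℝ)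
    (hB : ∀ v, v ≠ 0 → 0 < B v v) :
    Bornology.IsVonNBounded ℝ {v : Direction V | B v v < 1} := by
  have : ProperSpace (Direction V) := FiniteDimensional.proper ℝ _
  have hc : Continuous fun v : Direction V => B v v := by fun_prop
  rw [NormedSpace.isVonNBounded_iff]
  rcases subsingleton_or_nontrivial (Direction V) with h | h
  · exact (Set.toFinite _).isBounded
  obtain ⟨u, hu, hmin⟩ := (isCompact_sphere (0 : Direction V) 1).exists_isMinOn
    (NormedSpace.sphere_nonempty.2 zero_le_one) hc.continuousOn
  have hu0 : u ≠ 0 := by rintro rfl; simp at hu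
  have hpos := hB u hu0
  refine isBounded_iff_forall_norm_le.2 ⟨Real.sqrt (1 / B u u), fun v hv => ?_⟩
  apply Real.le_sqrt_of_sq_le
  rw [le_div_iff₀ hpos]
  rcases eq_or_ne v 0 with rfl | hv0
  · simp
  have hn : 0 < ‖v‖ := norm_pos_iff.2 hv0
  have h1 : B u u ≤ B (‖v‖⁻¹ • v) (‖v‖⁻¹ • v) := by
    apply hmin
    simp [norm_smul, hn.ne']
  simp only [map_smul, smul_apply, smul_eq_mul] at h1
  have hv' : B v v < 1 := hv
  calc ‖v‖ ^ 2 * B u u ≤ ‖v‖ ^ 2 * (‖v‖⁻¹ * (‖v‖⁻¹ * B v v)) := by gcongr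
    _ = B v v := by field_simp
    _ ≤ 1 := hv'.le

/-- The pull-back of bilinear forms on the ambient space to `V`. -/
def restrictForm : (E →L[ℝ] E →L[ℝ] ℝ) →L[ℝ] (Direction V →L[ℝ] Direction V →L[ℝ] ℝ) :=
  (ContinuousLinearMap.postcomp (Direction V) (ContinuousLinearMap.precomp ℝ (incl V))).comp
    (ContinuousLinearMap.precomp (E →L[ℝ] ℝ) (incl V))

/-- The pull-back of a bilinear form on the ambient space to the tangent space at `x`. -/
def tangentForm {s : Set E} {V : Submodule ℝ E} [AffineOpen s V] (B : E →L[ℝ] E →L[ℝ] ℝ) (x : s) :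
    TangentSpace 𝓘(ℝ, Direction V) x →L[ℝ] TangentSpace 𝓘(ℝ, Direction V) x →L[ℝ] ℝ :=
  (ContinuousLinearMap.precomp ℝ (emb x)).comp (B.comp (emb x))

theorem contMDiff_tangentForm (B : E → E →L[ℝ] E →L[ℝ] ℝ) (hB : ∀ x ∈ s, ContDiffAt ℝ ∞ B x) :
    ContMDiff 𝓘(ℝ, Direction V)
      (𝓘(ℝ, Direction V).prod 𝓘(ℝ, Direction V →L[ℝ] Direction V →L[ℝ] ℝ)) ∞
      (fun x : s => Bundle.TotalSpace.mk' (Direction V →L[ℝ] Direction V →L[ℝ] ℝ)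
        (E := fun x : s => TangentSpace 𝓘(ℝ, Direction V) x →L[ℝ]
          TangentSpace 𝓘(ℝ, Direction V) x →L[ℝ] ℝ)
        x (tangentForm (B x) x)) := by
  intro x
  rw [Bundle.contMDiffAt_section]
  have hB' : ContDiffAt ℝ ∞ (fun y => restrictForm V (B y)) (x : E) := by
    have h : ContDiff ℝ ∞ (restrictForm (E := E) V) := ContinuousLinearMap.contDiff _
    exact h.contDiffAt.comp (x : E) (hB x x.2)
  have h1 := hB'.contMDiffAt.comp x (contMDiff_val s V ∞).contMDiffAt
  refine h1.congr_of_eventuallyEq (Filter.Eventually.of_forall fun y => ?_)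
  have hy : y ∈ (chartAt (Direction V) x).source := by
    change y ∈ (chart s V ⟨x⟩).source
    simp [chart]
  have hb : y ∈ (trivializationAt (Direction V)
    (TangentSpace 𝓘(ℝ, Direction V)) x).baseSet := by simpa using hy
  have hsymm : ∀ v : Direction V, emb y ((trivializationAt (Direction V)
      (TangentSpace 𝓘(ℝ, Direction V)) x).symm y v) = incl V v := by
    intro v
    rw [← Bundle.Trivialization.symmL_apply (R := ℝ), TangentBundle.symmL_trivializationAt_eq_core hy]
    swap
    · exact hb
    have := tangentCoordChange_eq s V x y y
    unfold tangentCoordChange at this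
    rw [this]
    rfl
  ext v w
  change ContinuousLinearMap.inCoordinates (Direction V) (TangentSpace 𝓘(ℝ, Direction V))
    (Direction V →L[ℝ] ℝ) (fun x : s => TangentSpace 𝓘(ℝ, Direction V) x →L[ℝ] ℝ) x y x y
    (tangentForm (B y) y) v w = restrictForm V (B y) v w
  rw [inCoordinates_apply_eq₂ hb hb (Set.mem_univ _)]
  simp [hsymm, restrictForm, tangentForm]

/-- The Riemannian metric on `s` which at `x` is the restriction of the bilinear form `B x`. -/
def metric [FiniteDimensional ℝ E] (B : E → E →L[ℝ] E →L[ℝ] ℝ)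
    (hs : ∀ x ∈ s, ∀ v ∈ V, ∀ w ∈ V, B x v w = B x w v)
    (hp : ∀ x ∈ s, ∀ v ∈ V, v ≠ 0 → 0 < B x v v) (hB : ∀ x ∈ s, ContDiffAt ℝ ∞ B x) :
    Bundle.ContMDiffRiemannianMetric 𝓘(ℝ, Direction V) ∞ (Direction V)
      (fun x : s => TangentSpace 𝓘(ℝ, Direction V) x) where
  inner x := tangentForm (B x) x
  symm x v w := hs x x.2 _ (emb_mem x v) _ (emb_mem x w)
  pos x v hv := hp x x.2 _ (emb_mem x v)
    (fun h => hv (emb_injective x (h.trans (map_zero (emb x)).symm)))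
  isVonNBounded x := isVonNBounded_of_pos V (restrictForm V (B x))
    fun v hv => hp x x.2 _ (incl_mem V v)
      fun h => hv (incl_injective V (h.trans (map_zero (incl V)).symm))
  contMDiff := contMDiff_tangentForm s V B hB

end AffineOpen

/-! ### Riemannian notions on a manifold -/

section Riemannian

open scoped Bundle

variable {E : Type} [NormedAddCommGroup E] [NormedSpace ℝ E] [FiniteDimensional ℝ E]
  {H : Type} [TopologicalSpace H] {I : ModelWithCorners ℝ E H}
  {M : Type} [TopologicalSpace M] [ChartedSpace H M] [IsManifold I ∞ M]

/-- The Riemannian gradient: the tangent vector at `x` that represents the differential of `f` at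
`x` with respect to the metric `g`. -/
def riemannianGradient
    (g : Bundle.ContMDiffRiemannianMetric I ∞ E (fun x : M => TangentSpace I x))
    (f : M → ℝ) (x : M) : TangentSpace I x :=
  letI : Bundle.RiemannianBundle (fun x : M => TangentSpace I x) := ⟨g.toRiemannianMetric⟩
  haveI : FiniteDimensional ℝ (TangentSpace I x) := inferInstanceAs (FiniteDimensional ℝ E)
  haveI : CompleteSpace (TangentSpace I x) := FiniteDimensional.complete ℝ (TangentSpace I x)
  (InnerProductSpace.toDual ℝ (TangentSpace I x)).symm (mvfderiv I f x)

/-- The defining property of the Riemannian gradient. -/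
theorem inner_riemannianGradient
    (g : Bundle.ContMDiffRiemannianMetric I ∞ E (fun x : M => TangentSpace I x))
    (f : M → ℝ) (x : M) (ξ : TangentSpace I x) :
    g.inner x (riemannianGradient g f x) ξ = mvfderiv I f x ξ := by
  let _ : Bundle.RiemannianBundle (fun x : M => TangentSpace I x) := ⟨g.toRiemannianMetric⟩
  have : FiniteDimensional ℝ (TangentSpace I x) := inferInstanceAs (FiniteDimensional ℝ E)
  have : CompleteSpace (TangentSpace I x) := FiniteDimensional.complete ℝ (TangentSpace I x)
  exact InnerProductSpace.toDual_symm_apply (𝕜 := ℝ) (E := TangentSpace I x)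

/-- A connection on the tangent bundle is the Levi-Civita connection of `g` if it is compatible
with `g` and torsion free. -/
def IsLeviCivita
    (g : Bundle.ContMDiffRiemannianMetric I ∞ E (fun x : M => TangentSpace I x))
    (cov : CovariantDerivative I E (fun x : M => TangentSpace I x)) : Prop :=
  letI : Bundle.RiemannianBundle (fun x : M => TangentSpace I x) := ⟨g.toRiemannianMetric⟩
  haveI : IsManifold I 2 M := IsManifold.of_le (n := ∞) (by norm_cast)
  haveI : CompleteSpace E := FiniteDimensional.complete ℝ E
  CovariantDerivative.IsMetricCompatible (I := I) (M := M) (F := E)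
    (V := fun x : M => TangentSpace I x) (by exact cov) ∧ cov.torsion = 0

/-- `Hs` is the Hessian operator of `f` at `x` with respect to the connection `cov` and the metric
`g`: the operator that represents the second covariant derivative
`(ξ, Y) ↦ ξ (Y f) - (∇_ξ Y) f` of `f`. -/
def IsHessianAt
    (g : Bundle.ContMDiffRiemannianMetric I ∞ E (fun x : M => TangentSpace I x))
    (cov : CovariantDerivative I E (fun x : M => TangentSpace I x))
    (f : M → ℝ) (x : M) (Hs : TangentSpace I x →L[ℝ] TangentSpace I x) : Prop :=
  ∀ (ξ : TangentSpace I x) (Y : ∀ y : M, TangentSpace I y),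
    ContMDiff I (I.prod 𝓘(ℝ, E)) ∞
      (fun y => (Bundle.TotalSpace.mk' E y (Y y) : TangentBundle I M)) →
    g.inner x (Hs ξ) (Y x) =
      mvfderiv I (fun y => mvfderiv I f y (Y y)) x ξ - mvfderiv I f x (cov Y x ξ)

end Riemannian

namespace AffineOpen

/-- Vector fields on `s`. -/
abbrev VectorField {E : Type} [NormedAddCommGroup E] [NormedSpace ℝ E] (s : Set E)
    (V : Submodule ℝ E) [AffineOpen s V] : Type :=
  ∀ y : s, TangentSpace 𝓘(ℝ, Direction V) y

/-- The directional derivative `Dη[ξ]` at `x` of a vector field `η` on `s`, seen as a map with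
values in the ambient vector space. -/
def dirDeriv {E : Type} [NormedAddCommGroup E] [NormedSpace ℝ E] {s : Set E} {V : Submodule ℝ E}
    [AffineOpen s V] (η : VectorField s V) (x : s)
    (ξ : TangentSpace 𝓘(ℝ, Direction V) x) : E :=
  mvfderiv 𝓘(ℝ, Direction V) (fun y : s => emb y (η y)) x ξ

/-- A vector field is differentiable at `x`, as a section of the tangent bundle. -/
def DiffFieldAt {E : Type} [NormedAddCommGroup E] [NormedSpace ℝ E] {s : Set E}
    {V : Submodule ℝ E} [AffineOpen s V] (η : VectorField s V)
    (x : s) : Prop :=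
  MDifferentiableAt 𝓘(ℝ, Direction V) (𝓘(ℝ, Direction V).prod 𝓘(ℝ, Direction V))
    (fun y => (Bundle.TotalSpace.mk' (Direction V) y (η y) :
      TangentBundle 𝓘(ℝ, Direction V) s)) x

end AffineOpen

open AffineOpen

/-! ### The matrix simplex -/

/-- Tuples `(X_1, ..., X_K)` of real `n × n` matrices, with the entrywise supremum norm (only the
topology of this finite-dimensional space matters). -/
def MatTuple (n K : ℕ) : Type := Fin K → Matrix (Fin n) (Fin n) ℝ

namespace MatTuple
variable (n K : ℕ)

instance : NormedAddCommGroup (MatTuple n K) :=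
  inferInstanceAs (NormedAddCommGroup (Fin K → Fin n → Fin n → ℝ))
instance : NormedSpace ℝ (MatTuple n K) :=
  inferInstanceAs (NormedSpace ℝ (Fin K → Fin n → Fin n → ℝ))
instance : FiniteDimensional ℝ (MatTuple n K) :=
  inferInstanceAs (FiniteDimensional ℝ (Fin K → Fin n → Fin n → ℝ))

variable {n K}

/-- The `i`-th matrix of a tuple. -/
def mat (x : MatTuple n K) (i : Fin K) : Matrix (Fin n) (Fin n) ℝ := x i

/-- The tuple with given matrices. -/
def of (A : Fin K → Matrix (Fin n) (Fin n) ℝ) : MatTuple n K := A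

@[simp] theorem mat_of (A : Fin K → Matrix (Fin n) (Fin n) ℝ) (i : Fin K) : (of A).mat i = A i :=
  rfl
@[ext] theorem ext {x y : MatTuple n K} (h : ∀ i, x.mat i = y.mat i) : x = y := funext h
@[simp] theorem add_mat (x y : MatTuple n K) (i : Fin K) : (x + y).mat i = x.mat i + y.mat i := rfl
@[simp] theorem sub_mat (x y : MatTuple n K) (i : Fin K) : (x - y).mat i = x.mat i - y.mat i := rfl
@[simp] theorem neg_mat (x : MatTuple n K) (i : Fin K) : (-x).mat i = -x.mat i := rfl
@[simp] theorem zero_mat (i : Fin K) : (0 : MatTuple n K).mat i = 0 := rfl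
@[simp] theorem smul_mat (c : ℝ) (x : MatTuple n K) (i : Fin K) : (c • x).mat i = c • x.mat i := rfl

/-- A matrix entry, as a continuous linear functional. -/
def entry (i : Fin K) (a b : Fin n) : MatTuple n K →L[ℝ] ℝ :=
  LinearMap.toContinuousLinearMap
    { toFun := fun x => x.mat i a b, map_add' := fun _ _ => rfl, map_smul' := fun _ _ => rfl }

theorem entry_apply (i : Fin K) (a b : Fin n) (x : MatTuple n K) : entry i a b x = x.mat i a b :=
  rfl

end MatTuple

/-- The product `SPD_n × ... × SPD_n` of `K` copies of the symmetric positive definite matrices. -/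
def spdProduct (n K : ℕ) : Set (MatTuple n K) := {x | ∀ i, (x.mat i).PosDef}

/-- The matrix simplex: tuples of symmetric positive definite matrices with sum `I`. -/
def matrixSimplex (n K : ℕ) : Set (MatTuple n K) := {x | (∀ i, (x.mat i).PosDef) ∧ ∑ i, x.mat i = 1}

/-- Tuples of symmetric matrices: the tangent space of `spdProduct n K` at every point. -/
def symTuples (n K : ℕ) : Submodule ℝ (MatTuple n K) where
  carrier := {ξ | ∀ i, (ξ.mat i).IsSymm}
  zero_mem' := fun _ => Matrix.isSymm_zero
  add_mem' := fun ha hb i => (ha i).add (hb i)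
  smul_mem' := fun c _ ha i => (ha i).smul c

/-- Tuples of symmetric matrices with sum zero: the tangent space of `matrixSimplex n K` at every
point. -/
def simplexTangent (n K : ℕ) : Submodule ℝ (MatTuple n K) where
  carrier := {ξ | (∀ i, (ξ.mat i).IsSymm) ∧ ∑ i, ξ.mat i = 0}
  zero_mem' := ⟨fun _ => Matrix.isSymm_zero, by simp⟩
  add_mem' := fun ha hb =>
    ⟨fun i => (ha.1 i).add (hb.1 i), by
      simp [Finset.sum_add_distrib, ha.2, hb.2]⟩
  smul_mem' := fun c _ ha => ⟨fun i => (ha.1 i).smul c, by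
      simp [← Finset.smul_sum, ha.2]⟩

theorem isOpen_posDef_symm {T : Type} [TopologicalSpace T] {n : ℕ}
    (A : T → Matrix (Fin n) (Fin n) ℝ) (hA : Continuous A) (hs : ∀ t, (A t).IsSymm) :
    IsOpen {t | (A t).PosDef} := by
  have key : ∀ t, (A t).PosDef ↔
      ∀ v ∈ Metric.sphere (0 : Fin n → ℝ) 1, 0 < v ⬝ᵥ (A t *ᵥ v) := by
    intro t
    rw [Matrix.posDef_iff_dotProduct_mulVec]
    constructor
    · rintro ⟨_, h⟩ v hv
      have hv0 : v ≠ 0 := by rintro rfl; simp at hv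
      simpa using h hv0
    · intro h
      refine ⟨by simpa [Matrix.IsSymm, Matrix.IsHermitian] using hs t, fun v hv => ?_⟩
      have hn : 0 < ‖v‖ := norm_pos_iff.2 hv
      have h1 := h (‖v‖⁻¹ • v) (by simp [norm_smul, hn.ne'])
      rw [Matrix.mulVec_smul, dotProduct_smul, smul_dotProduct] at h1
      simp only [smul_eq_mul] at h1
      have h2 : v ⬝ᵥ (A t *ᵥ v) = ‖v‖ * (‖v‖ * (‖v‖⁻¹ * (‖v‖⁻¹ * (v ⬝ᵥ (A t *ᵥ v))))) := by
        field_simp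
      simp only [star_trivial]
      rw [h2]; positivity
  simp only [key]
  rw [isOpen_iff_mem_nhds]
  intro t ht
  refine (isCompact_sphere (0 : Fin n → ℝ) 1).eventually_forall_of_forall_eventually
    (P := fun t v => 0 < v ⬝ᵥ (A t *ᵥ v)) fun v hv => ?_
  have hc : Continuous fun z : T × (Fin n → ℝ) => z.2 ⬝ᵥ (A z.1 *ᵥ z.2) := by fun_prop
  exact (isOpen_lt continuous_const hc).mem_nhds (ht v hv)

theorem continuous_apply_incl {n K : ℕ} (V : Submodule ℝ (MatTuple n K)) (i : Fin K)
    (c : MatTuple n K) : Continuous fun v : Direction V => (c + incl V v).mat i := by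
  refine continuous_pi fun a => continuous_pi fun b => ?_
  exact (MatTuple.entry i a b).continuous.comp (continuous_const.add (incl V).continuous)

instance spdProduct.affineOpen (n K : ℕ) : AffineOpen (spdProduct n K) (symTuples n K) where
  base := 0
  sub_mem x hx := fun i => by
    simpa [Matrix.IsSymm, Matrix.IsHermitian] using (hx i).1
  isOpen_preimage := by
    have : {v : Direction (symTuples n K) | 0 + incl _ v ∈ spdProduct n K} =
        ⋂ i, {v | ((0 + incl (symTuples n K) v).mat i).PosDef} := by
      ext v; simp [spdProduct]
    rw [this]
    refine isOpen_iInter_of_finite fun i =>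
      isOpen_posDef_symm _ (continuous_apply_incl _ i 0) fun v => ?_
    simpa using! incl_mem _ v i

instance matrixSimplex.affineOpen (n K : ℕ) :
    AffineOpen (matrixSimplex n K) (simplexTangent n K) where
  base := MatTuple.of fun _ => (K : ℝ)⁻¹ • (1 : Matrix (Fin n) (Fin n) ℝ)
  sub_mem x hx := by
    refine ⟨fun i => ?_, ?_⟩
    · have h1 : (x.mat i).IsSymm := by simpa [Matrix.IsSymm, Matrix.IsHermitian] using (hx.1 i).1
      exact h1.sub (Matrix.isSymm_one.smul _)
    · have h1 : ∑ i, (x.mat i - (K : ℝ)⁻¹ • (1 : Matrix (Fin n) (Fin n) ℝ)) = 0 := by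
        rw [Finset.sum_sub_distrib, hx.2]
        rcases Nat.eq_zero_or_pos K with rfl | hK
        · have := hx.2
          simp at this
          simp [← this]
        · have : (K : ℝ) ≠ 0 := by positivity
          simp [← Nat.cast_smul_eq_nsmul ℝ, smul_smul, this]
      exact h1
  isOpen_preimage := by
    let c : MatTuple n K := MatTuple.of fun _ => (K : ℝ)⁻¹ • (1 : Matrix (Fin n) (Fin n) ℝ)
    by_cases hc : ∑ i, c.mat i = 1
    · have : {v : Direction (simplexTangent n K) | c + incl _ v ∈ matrixSimplex n K} =
          ⋂ i, {v | ((c + incl (simplexTangent n K) v).mat i).PosDef} := by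
        ext v
        have h0 : ∑ i, (c + incl (simplexTangent n K) v).mat i = 1 := by
          simp only [MatTuple.add_mat]
          rw [Finset.sum_add_distrib, hc, (incl_mem _ v).2, add_zero]
        simp only [matrixSimplex, Set.mem_ofPred_eq, Set.mem_iInter]
        exact ⟨fun h => h.1, fun h => ⟨h, h0⟩⟩
      rw [this]
      refine isOpen_iInter_of_finite fun i =>
        isOpen_posDef_symm _ (continuous_apply_incl _ i c) fun v => ?_
      exact (Matrix.isSymm_one.smul _).add ((incl_mem _ v).1 i)
    · have : {v : Direction (simplexTangent n K) | c + incl _ v ∈ matrixSimplex n K} = ∅ := by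
        ext v
        have h0 : ∑ i, (c + incl (simplexTangent n K) v).mat i = ∑ i, c.mat i := by
          simp only [MatTuple.add_mat]
          rw [Finset.sum_add_distrib, (incl_mem _ v).2, add_zero]
        simp only [Set.mem_empty_iff_false, iff_false]
        intro h
        exact hc (h0.symm.trans h.2)
      rw [this]
      exact isOpen_empty

/-- The bilinear form `(ξ, η) ↦ ∑ i, tr (X_i⁻¹ ξ_i X_i⁻¹ η_i)`. -/
def affineInvariantForm {n K : ℕ} (x : MatTuple n K) :
    MatTuple n K →L[ℝ] MatTuple n K →L[ℝ] ℝ :=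
  LinearMap.toContinuousBilinearMap <| LinearMap.mk₂ ℝ
    (fun ξ η => ∑ i, ((x.mat i)⁻¹ * ξ.mat i * (x.mat i)⁻¹ * η.mat i).trace)
    (fun _ _ _ => by simp [Matrix.mul_add, Matrix.add_mul, Finset.sum_add_distrib])
    (fun _ _ _ => by simp [Finset.mul_sum])
    (fun _ _ _ => by simp [Matrix.mul_add, Finset.sum_add_distrib])
    (fun _ _ _ => by simp [Finset.mul_sum])

@[simp] theorem affineInvariantForm_apply {n K : ℕ} (x ξ η : MatTuple n K) :
    affineInvariantForm x ξ η = ∑ i, ((x.mat i)⁻¹ * ξ.mat i * (x.mat i)⁻¹ * η.mat i).trace := rfl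

theorem affineInvariantForm_symm {n K : ℕ} (x ξ η : MatTuple n K) :
    affineInvariantForm x ξ η = affineInvariantForm x η ξ := by
  simp only [affineInvariantForm_apply]
  refine Finset.sum_congr rfl fun i _ => ?_
  rw [Matrix.mul_assoc, Matrix.trace_mul_comm]
  simp only [Matrix.mul_assoc]

open scoped MatrixOrder in
theorem trace_form_nonneg {n : ℕ} {X A : Matrix (Fin n) (Fin n) ℝ} (hX : X.PosDef)
    (hA : A.IsSymm) :
    0 ≤ (X⁻¹ * A * X⁻¹ * A).trace ∧ ((X⁻¹ * A * X⁻¹ * A).trace = 0 → A = 0) := by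
  have hP := hX.inv
  obtain ⟨B, hB⟩ := CStarAlgebra.nonneg_iff_eq_star_mul_self.mp hP.posSemidef.nonneg
  rw [Matrix.star_eq_conjTranspose] at hB
  have hAH : Aᴴ = A := by simpa [Matrix.IsSymm] using hA
  have hu : IsUnit B := by
    have h1 := hP.isUnit
    rw [hB, Matrix.isUnit_iff_isUnit_det, Matrix.det_mul] at h1
    rw [Matrix.isUnit_iff_isUnit_det]
    exact isUnit_of_mul_isUnit_right h1
  have hu' : IsUnit Bᴴ := by
    rw [Matrix.isUnit_iff_isUnit_det, Matrix.det_conjTranspose] 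
    exact ((Matrix.isUnit_iff_isUnit_det _).1 hu).star
  have h2 : (X⁻¹ * A * X⁻¹ * A).trace = ((B * A * Bᴴ)ᴴ * (B * A * Bᴴ)).trace := by
    rw [hB, Matrix.conjTranspose_mul, Matrix.conjTranspose_mul, hAH,
      Matrix.conjTranspose_conjTranspose]
    have : B * (A * Bᴴ) * (B * A * Bᴴ) = (B * A * Bᴴ * B * A) * Bᴴ := by
      simp only [Matrix.mul_assoc]
    rw [this, Matrix.trace_mul_comm _ Bᴴ]
    simp only [Matrix.mul_assoc]
  rw [h2]
  refine ⟨(Matrix.posSemidef_conjTranspose_mul_self _).trace_nonneg, fun h => ?_⟩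
  rw [Matrix.trace_conjTranspose_mul_self_eq_zero_iff] at h
  have h3 : B * A = 0 := by
    apply hu'.mul_left_injective
    simpa using h
  apply hu.mul_right_injective
  simpa using h3

theorem affineInvariantForm_pos {n K : ℕ} (x : MatTuple n K) (hx : x ∈ spdProduct n K)
    (ξ : MatTuple n K) (hξ : ξ ∈ symTuples n K) (h0 : ξ ≠ 0) : 0 < affineInvariantForm x ξ ξ := by
  rw [affineInvariantForm_apply]
  obtain ⟨j, hj⟩ : ∃ j, ξ.mat j ≠ 0 := by
    by_contra! h
    exact h0 (MatTuple.ext h)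
  exact Finset.sum_pos' (fun i _ => (trace_form_nonneg (hx i) (hξ i)).1)
    ⟨j, Finset.mem_univ j, lt_of_le_of_ne (trace_form_nonneg (hx j) (hξ j)).1
      fun h => hj ((trace_form_nonneg (hx j) (hξ j)).2 h.symm)⟩

theorem contDiffAt_affineInvariantForm {n K : ℕ} (x : MatTuple n K) (hx : x ∈ spdProduct n K) :
    ContDiffAt ℝ ∞ affineInvariantForm x := by
  let U : Set (MatTuple n K) := {y | ∀ i, (y.mat i).det ≠ 0}
  have hdet : ∀ (g : MatTuple n K → Matrix (Fin n) (Fin n) ℝ),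
      (∀ a b, ContDiff ℝ ∞ fun y => g y a b) → ContDiff ℝ ∞ fun y => (g y).det := by
    intro g hg
    simp only [Matrix.det_apply]
    exact ContDiff.sum fun σ _ => (contDiff_prod fun a _ => hg _ _).const_smul (σ.sign : ℤˣ)
  have hent : ∀ (i : Fin K) a b, ContDiff ℝ ∞ fun y : MatTuple n K => y.mat i a b :=
    fun i a b => (MatTuple.entry i a b).contDiff
  have hU : IsOpen U := by
    have : U = ⋂ i, {y : MatTuple n K | (y.mat i).det ≠ 0} := by ext y; simp [U]
    rw [this]
    exact isOpen_iInter_of_finite fun i =>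
      isOpen_ne_fun (hdet _ (hent i)).continuous continuous_const
  have hxU : x ∈ U := fun i => (hx i).det_pos.ne'
  have hinv : ∀ (i : Fin K) a b, ContDiffOn ℝ ∞ (fun y : MatTuple n K => (y.mat i)⁻¹ a b) U := by
    intro i a b
    have h1 : (fun y : MatTuple n K => (y.mat i)⁻¹ a b) =
        fun y => ((y.mat i).det)⁻¹ * ((y.mat i).updateRow b (Pi.single a 1)).det := by
      funext y
      rw [Matrix.inv_def, Ring.inverse_eq_inv', Matrix.smul_apply, Matrix.adjugate_apply,
        smul_eq_mul]
    rw [h1]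
    have hU' : ∀ y ∈ U, (y.mat i).det ≠ 0 := fun y hy => hy i
    refine ((hdet _ (hent i)).contDiffOn.inv hU').mul
      (hdet _ fun c d => ?_).contDiffOn
    by_cases hc : c = b
    · subst hc
      simp only [Matrix.updateRow_self]
      exact contDiff_const
    · simp only [Matrix.updateRow_ne hc]
      exact hent i c d
  have h : ContDiffOn ℝ ∞ affineInvariantForm U := by
    rw [contDiffOn_clm_apply]
    intro ξ
    rw [contDiffOn_clm_apply]
    intro η
    simp only [affineInvariantForm_apply, Matrix.trace, Matrix.diag_apply, Matrix.mul_apply]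
    refine ContDiffOn.sum fun i _ => ContDiffOn.sum fun a _ => ContDiffOn.sum fun b _ =>
      ContDiffOn.mul (ContDiffOn.sum fun c _ => ContDiffOn.mul (ContDiffOn.sum fun d _ =>
        ContDiffOn.mul (hinv i _ _) contDiffOn_const) (hinv i _ _)) contDiffOn_const
  exact h.contDiffAt (hU.mem_nhds hxU)

/-- The affine-invariant metric on `spdProduct n K`. -/
def spdMetric (n K : ℕ) := AffineOpen.metric (spdProduct n K) (symTuples n K) affineInvariantForm
  (fun x _ ξ _ η _ => affineInvariantForm_symm x ξ η) affineInvariantForm_pos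
  contDiffAt_affineInvariantForm

/-- The metric on `matrixSimplex n K`. -/
def simplexMetric (n K : ℕ) :=
  AffineOpen.metric (matrixSimplex n K) (simplexTangent n K) affineInvariantForm
  (fun x _ ξ _ η _ => affineInvariantForm_symm x ξ η)
  (fun x hx ξ hξ h0 => affineInvariantForm_pos x hx.1 ξ hξ.1 h0)
  fun x hx => contDiffAt_affineInvariantForm x hx.1

/-- `p` minimises `-g_x(z, ξ) + g_x(ξ, ξ) / 2` over the tangent vectors `ξ` of the simplex. -/
def IsTangentProjection {n K : ℕ} (x z p : MatTuple n K) : Prop :=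
  p ∈ simplexTangent n K ∧ ∀ ξ ∈ simplexTangent n K,
    -affineInvariantForm x z p + 1 / 2 * affineInvariantForm x p p ≤
      -affineInvariantForm x z ξ + 1 / 2 * affineInvariantForm x ξ ξ

/-- The projection `Π_x` onto the tangent space: the minimiser in `IsTangentProjection`. -/
def tangentProjection {n K : ℕ} (x z : MatTuple n K) : MatTuple n K :=
  Classical.epsilon (IsTangentProjection x z)

/-- The symmetric matrix `Λ` solves `∑ i, X_i Λ X_i = -∑ i, Z_i`. -/
def IsMultiplier {n K : ℕ} (x z : MatTuple n K) (Λ : Matrix (Fin n) (Fin n) ℝ) : Prop :=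
  Λ.IsSymm ∧ ∑ i, x.mat i * Λ * x.mat i = -∑ i, z.mat i

/-- The symmetric part of a matrix. -/
def symPart {n : ℕ} (A : Matrix (Fin n) (Fin n) ℝ) : Matrix (Fin n) (Fin n) ℝ :=
  (1 / 2 : ℝ) • (A + Aᵀ)

/-- `G` is a Euclidean partial gradient `∇_{X_i} f` at `x` of a function `f` on `spdProduct n K`:
the derivative of `f` at `x` in the direction of a symmetric change `H` of the `i`-th matrix is
`tr (Gᵀ H)`. This fixes the symmetric part of `G`. -/
def IsPartialGradient {n K : ℕ} (f : MatTuple n K → ℝ) (x : MatTuple n K) (i : Fin K)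
    (G : Matrix (Fin n) (Fin n) ℝ) : Prop :=
  ∀ H : Matrix (Fin n) (Fin n) ℝ, H.IsSymm →
    HasDerivAt (fun t : ℝ => f (MatTuple.of (Function.update x.mat i (x.mat i + t • H)))) (Gᵀ * H).trace 0

/-- `G` is the tuple of Euclidean partial gradients `∇_{X_i} f` at `x`. -/
def IsEuclideanGradient {n K : ℕ} (f : MatTuple n K → ℝ) (x G : MatTuple n K) : Prop :=
  ∀ i, IsPartialGradient f x i (G.mat i)

/-- If `f` is differentiable at `x` as a function of all the matrix entries, then the matrix of
its partial derivatives is a partial gradient. -/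
theorem isPartialGradient_of_differentiableAt {n K : ℕ} (f : MatTuple n K → ℝ) (x : MatTuple n K)
    (hf : DifferentiableAt ℝ f x) (i : Fin K) :
    IsPartialGradient f x i
      (Matrix.of fun a b => fderiv ℝ f x (MatTuple.of (Pi.single i (Matrix.single a b (1 : ℝ))))) := by
  intro H _
  have h1 : ∀ t : ℝ, MatTuple.of (Function.update x.mat i (x.mat i + t • H)) =
      x + t • MatTuple.of (Pi.single i H) := by
    intro t
    ext1 j
    by_cases hj : j = i
    · subst hj; simp
    · simp [hj]
  have h2 : MatTuple.of (Pi.single i H) =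
      ∑ a, ∑ b, H a b • MatTuple.of (Pi.single i (Matrix.single a b (1 : ℝ))) := by
    have h3 : ∀ s : Finset (Fin n × Fin n),
        (∑ p ∈ s, H p.1 p.2 • MatTuple.of (K := K)
          (Pi.single i (Matrix.single p.1 p.2 (1 : ℝ)))).mat i =
        ∑ p ∈ s, H p.1 p.2 • Matrix.single p.1 p.2 (1 : ℝ) := by
      intro s
      induction s using Finset.induction_on with
      | empty => simp
      | insert a s ha ih => simp [Finset.sum_insert ha, ih]
    have h4 : ∀ (j : Fin K), j ≠ i → ∀ s : Finset (Fin n × Fin n),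
        (∑ p ∈ s, H p.1 p.2 • MatTuple.of (K := K)
          (Pi.single i (Matrix.single p.1 p.2 (1 : ℝ)))).mat j = 0 := by
      intro j hj s
      induction s using Finset.induction_on with
      | empty => simp
      | insert a s ha ih => simp [Finset.sum_insert ha, ih, hj]
    rw [← Fintype.sum_prod_type' (f := fun a b => H a b • MatTuple.of (K := K)
      (Pi.single i (Matrix.single a b (1 : ℝ))))]
    ext1 j
    by_cases hj : j = i
    · subst hj
      rw [h3, Fintype.sum_prod_type]
      conv_lhs => rw [MatTuple.mat_of, Pi.single_eq_same, Matrix.matrix_eq_sum_single H]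
      simp [Matrix.smul_single]
    · rw [h4 j hj]; simp [hj]
  have h5 := (hf.hasFDerivAt.hasLineDerivAt (MatTuple.of (Pi.single i H)))
  have h6 : ((Matrix.of fun a b => fderiv ℝ f x
      (MatTuple.of (Pi.single i (Matrix.single a b (1 : ℝ)))))ᵀ * H).trace =
      fderiv ℝ f x (MatTuple.of (Pi.single i H)) := by
    rw [h2]
    simp only [map_sum, map_smul, smul_eq_mul]
    rw [Matrix.trace_mul_comm]
    simp [Matrix.trace, Matrix.mul_apply]
  rw [h6]
  simp only [h1]
  exact h5

/-- The inclusion of the matrix simplex in `spdProduct n K`. -/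
def simplexToSpd {n K : ℕ} (x : matrixSimplex n K) : spdProduct n K := ⟨x, x.2.1⟩

/-- The tuple of the matrices `X_i symm(G_i) X_i`. -/
def scaledGradient {n K : ℕ} (x G : MatTuple n K) : MatTuple n K :=
  MatTuple.of fun i => x.mat i * symPart (G.mat i) * x.mat i

/-- The tuple of the matrices `symm(ξ_i X_i⁻¹ η_i)`. -/
def connectionTerm {n K : ℕ} (x ξ η : MatTuple n K) : MatTuple n K :=
  MatTuple.of fun i => symPart (ξ.mat i * (x.mat i)⁻¹ * η.mat i)

end

open AffineOpen
open scoped Manifold ContDiff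

/-!
The product of positive definite cones and the matrix simplex are relatively open subsets `s` of
affine subspaces `base + V` of a common vector space, so each has a global chart, the tangent spaces
are all `V`, and a vector field is a map `s → V`. A metric is a smooth family of bilinear forms
`B x` on the ambient space, positive definite on `V`. Everything below rests on the `B x`-orthogonal
projection `formProj` onto `V`, which is smooth in `x` because inversion of linear maps is smooth
(`contDiffAt_formProj`). Completing the square shows that it is the minimiser `Π_x`
(`isMin_iff_eq_formProj`), and a gradient is the vector of `V` that represents the differential,
hence the projection of any ambient vector that represents it on `V`.

For the connection, suppose that a smooth bilinear map `G x`, symmetric on `V`, satisfies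
`DB[ξ](η, ζ) = -(B (G (ξ, η), ζ) + B (G (ξ, ζ), η))` for `ξ, η, ζ ∈ V`. Then
`∇_ξ η = Π (Dη[ξ] - G (ξ, η))` is metric by the product rule and torsion free by the symmetry of `G`
(`isLeviCivita_projConnection`). The difference of two Levi-Civita connections is a tensor that is
symmetric in its arguments and skew with respect to the metric, so it vanishes
(`isLeviCivita_unique`); every Levi-Civita connection is therefore given by this formula on
differentiable fields. For the affine-invariant metric, differentiating `X⁻¹` shows that
`G (ξ, η) = symm (ξ_i X_i⁻¹ η_i)` has the required property
(`fderiv_affineInvariantForm_eq_connectionForm`). Since this single ambient `G` serves both `S` and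
the simplex, the connection of the simplex is the projection of that of `S`.

The multiplier `Λ` exists and is unique because `Λ ↦ ∑ X_i Λ X_i` is injective on symmetric
matrices: `tr (Λ ∑ X_i Λ X_i)` is the sum of the `tr (X_i Λ X_i Λ) ≥ 0`. Metric compatibility applied
to `Y f = g (grad f, Y)` gives the Hessian as `∇ grad f`, and constant vector fields show that the
defining identity determines it.

A function `f` smooth on the positive definite tuples is only given on a set with empty interior in
the space of all tuples; it is replaced by `f ∘ symmetrize`, which has the same values there and is
smooth in a neighbourhood.
-/

noncomputable section

open Direction
open scoped Bundle

/-! ### Calculus in the global chart -/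

namespace AffineOpen
variable {E : Type} [NormedAddCommGroup E] [NormedSpace ℝ E] {s : Set E} {V : Submodule ℝ E}
  [AffineOpen s V] {W : Type} [NormedAddCommGroup W] [NormedSpace ℝ W]

/-- A vector of the model space, as a tangent vector at `y`. -/
def ofModel (y : s) (v : Direction V) : TangentSpace 𝓘(ℝ, Direction V) y := v

/-- The vector field with constant value `v`. -/
def constField (v : Direction V) : VectorField s V := fun y => ofModel y v

/-- A linear map of the model space, as a map of the tangent space at `y`. -/
def ofModelMap (y : s) (A : Direction V →L[ℝ] Direction V) :
    TangentSpace 𝓘(ℝ, Direction V) y →L[ℝ] TangentSpace 𝓘(ℝ, Direction V) y := A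

/-- A vector field, as a map with values in the model space. The trivializations of the tangent
bundle are the identity, so this is its expression in coordinates. -/
def components (η : VectorField s V) : s → Direction V := η

theorem chart_symm_coord (h : Nonempty s) (y : s) : (chart s V h).symm (coord s V y) = y := by
  have : y ∈ (chart s V h).source := by simp [chart]
  exact (chart s V h).left_inv this

theorem coord_chart_symm (h : Nonempty s) {v : Direction V} (hv : v ∈ (chart s V h).target) :
    coord s V ((chart s V h).symm v) = v := (chart s V h).right_inv hv

theorem coord_mem_target (h : Nonempty s) (y : s) : coord s V y ∈ (chart s V h).target := by
  have : y ∈ (chart s V h).source := by simp [chart]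
  exact (chart s V h).map_source this

theorem target_mem_nhds (h : Nonempty s) (y : s) : (chart s V h).target ∈ 𝓝 (coord s V y) :=
  (chart s V h).open_target.mem_nhds (coord_mem_target h y)

theorem val_chart_symm (h : Nonempty s) {v : Direction V} (hv : v ∈ (chart s V h).target) :
    (((chart s V h).symm v : s) : E) = base s V + incl V v := by
  rw [← base_add_incl_coord s V, coord_chart_symm h hv]

theorem continuousAt_of_comp_chart_symm {T : Type} [TopologicalSpace T] {g : s → T} {x : s}
    (hg : ContinuousAt (g ∘ (chart s V ⟨x⟩).symm) (coord s V x)) : ContinuousAt g x := by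
  have h1 : g = (g ∘ (chart s V ⟨x⟩).symm) ∘ coord s V := by
    funext y; simp [chart_symm_coord]
  rw [h1]
  exact hg.comp (isOpenEmbedding_coord s V).continuous.continuousAt

/-- Derivatives on `s` are derivatives in the global chart: `s` has only one chart, so the chart used
at `x` is the same for all `x`. -/
theorem hasMFDerivAt_iff {g : s → W} {x : s} {g' : Direction V →L[ℝ] W} :
    HasMFDerivAt 𝓘(ℝ, Direction V) 𝓘(ℝ, W) g x g' ↔
      HasFDerivAt (g ∘ (chart s V ⟨x⟩).symm) g' (coord s V x) := by
  constructor
  · intro h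
    have h2 : HasFDerivWithinAt (g ∘ (chart s V ⟨x⟩).symm) g' (Set.range 𝓘(ℝ, Direction V))
      (coord s V x) := h.2
    rwa [ModelWithCorners.range_eq_univ, hasFDerivWithinAt_univ] at h2
  · intro h
    refine ⟨continuousAt_of_comp_chart_symm h.continuousAt, ?_⟩
    have h2 : HasFDerivWithinAt (g ∘ (chart s V ⟨x⟩).symm) g' (Set.range 𝓘(ℝ, Direction V))
      (coord s V x) := h.hasFDerivWithinAt
    exact h2

/-- The derivative of a map on `s`, with the tangent spaces identified with the model space. -/
def modelDeriv (g : s → W) (y : s) : Direction V →L[ℝ] W :=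
  (mvfderiv 𝓘(ℝ, Direction V) g y : Direction V →L[ℝ] W)

theorem hasFDerivAt_modelDeriv {g : s → W} {x : s}
    (hg : MDifferentiableAt 𝓘(ℝ, Direction V) 𝓘(ℝ, W) g x) :
    HasFDerivAt (g ∘ (chart s V ⟨x⟩).symm) (modelDeriv g x)
      (coord s V x) :=
  hasMFDerivAt_iff.1 hg.hasMFDerivAt

theorem modelDeriv_eq {g : s → W} {x : s} {g' : Direction V →L[ℝ] W}
    (h : HasFDerivAt (g ∘ (chart s V ⟨x⟩).symm) g' (coord s V x)) :
    modelDeriv g x = g' :=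
  (hasMFDerivAt_iff.2 h).mfderiv

theorem contMDiffAt_iff_chart {g : s → W} {x : s} {n : ℕ∞ω} :
    ContMDiffAt 𝓘(ℝ, Direction V) 𝓘(ℝ, W) n g x ↔
      ContDiffAt ℝ n (g ∘ (chart s V ⟨x⟩).symm) (coord s V x) := by
  rw [_root_.contMDiffAt_iff, ModelWithCorners.range_eq_univ, contDiffWithinAt_univ]
  exact ⟨fun h => h.2, fun h => ⟨continuousAt_of_comp_chart_symm h.continuousAt, h⟩⟩

theorem contMDiff_modelDeriv {g : s → W} (hg : ContMDiff 𝓘(ℝ, Direction V) 𝓘(ℝ, W) ∞ g) :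
    ContMDiff 𝓘(ℝ, Direction V) 𝓘(ℝ, Direction V →L[ℝ] W) ∞
      (modelDeriv g : s → Direction V →L[ℝ] W) := by
  intro x
  rw [contMDiffAt_iff_chart]
  have h1 := (contMDiffAt_iff_chart.1 (hg x)).fderiv_right (m := ∞) (by simp)
  refine h1.congr_of_eventuallyEq ?_
  filter_upwards [target_mem_nhds ⟨x⟩ x] with v hv
  have h2 := hasFDerivAt_modelDeriv ((hg ((chart s V ⟨x⟩).symm v)).mdifferentiableAt (by simp))
  rw [coord_chart_symm _ hv] at h2
  exact h2.fderiv.symm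

/-! ### Vector fields in the global chart -/

theorem mem_baseSet (x y : s) : y ∈ (trivializationAt (Direction V)
    (TangentSpace 𝓘(ℝ, Direction V)) x).baseSet := by
  have hy : y ∈ (chartAt (Direction V) x).source := by
    change y ∈ (chart s V ⟨x⟩).source
    simp [chart]
  simpa using hy

theorem trivializationAt_symm (x y : s) (v : Direction V) :
    (trivializationAt (Direction V) (TangentSpace 𝓘(ℝ, Direction V)) x).symm y v = v := by
  have hy : y ∈ (chartAt (Direction V) x).source := by
    change y ∈ (chart s V ⟨x⟩).source
    simp [chart]
  rw [← Bundle.Trivialization.symmL_apply (R := ℝ), TangentBundle.symmL_trivializationAt_eq_core hy]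
  swap
  · exact mem_baseSet x y
  have := tangentCoordChange_eq s V x y y
  unfold tangentCoordChange at this
  rw [this]
  rfl

theorem trivializationAt_apply (x y : s) (v : Direction V) :
    (trivializationAt (Direction V) (TangentSpace 𝓘(ℝ, Direction V)) x
      (Bundle.TotalSpace.mk' (Direction V) y (v : TangentSpace 𝓘(ℝ, Direction V) y))).2 = v := by
  have h := (trivializationAt (Direction V) (TangentSpace 𝓘(ℝ, Direction V)) x).apply_mk_symm
    (mem_baseSet x y) v
  rw [trivializationAt_symm] at h
  exact congrArg Prod.snd h

theorem diffFieldAt_iff {η : VectorField s V} {x : s} :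
    DiffFieldAt η x ↔ MDifferentiableAt 𝓘(ℝ, Direction V) 𝓘(ℝ, Direction V) (components η) x := by
  rw [DiffFieldAt, mdifferentiableAt_section]
  exact Iff.of_eq (congrArg (fun g => MDifferentiableAt 𝓘(ℝ, Direction V) 𝓘(ℝ, Direction V) g x)
    (funext fun y => trivializationAt_apply x y (η y)))

theorem contMDiffAt_field_iff {η : VectorField s V} {x : s} {n : ℕ∞ω} :
    ContMDiffAt 𝓘(ℝ, Direction V) (𝓘(ℝ, Direction V).prod 𝓘(ℝ, Direction V)) n
      (fun y => (Bundle.TotalSpace.mk' (Direction V) y (η y) :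
        TangentBundle 𝓘(ℝ, Direction V) s)) x ↔
    ContMDiffAt 𝓘(ℝ, Direction V) 𝓘(ℝ, Direction V) n (components η) x := by
  rw [Bundle.contMDiffAt_section]
  exact Iff.of_eq (congrArg (fun g => ContMDiffAt 𝓘(ℝ, Direction V) 𝓘(ℝ, Direction V) n g x)
    (funext fun y => trivializationAt_apply x y (η y)))

/-- The trivializations of the bundle of endomorphisms of the tangent spaces are the identity. -/
theorem inCoordinates_eq (x y : s) (A : Direction V →L[ℝ] Direction V) :
    ContinuousLinearMap.inCoordinates (Direction V) (TangentSpace 𝓘(ℝ, Direction V))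
      (Direction V) (TangentSpace 𝓘(ℝ, Direction V)) x y x y (ofModelMap y A) = A := by
  ext v
  rw [ContinuousLinearMap.inCoordinates_eq (mem_baseSet x y) (mem_baseSet x y)]
  have h1 := trivializationAt_symm x y v
  have h2 := fun w => trivializationAt_apply (V := V) x y w
  simp only [ContinuousLinearMap.comp_apply, ContinuousLinearEquiv.coe_coe,
    Bundle.Trivialization.symm_continuousLinearEquivAt_eq,
    Bundle.Trivialization.continuousLinearEquivAt_apply]
  have h3 : Bundle.Trivialization.symmL ℝ (trivializationAt (Direction V)
      (TangentSpace 𝓘(ℝ, Direction V)) x) y v = ofModel y v := by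
    rw [Bundle.Trivialization.symmL_apply]
    · exact h1
    · exact mem_baseSet x y
  rw [h3]
  exact h2 (A v)

/-- The derivative of the inverse chart is the identity, because the tangent space at a point is
identified with the model space by the same chart. -/
theorem mfderivWithin_chart_symm (x : s) {v : Direction V} (hv : v ∈ (chart s V ⟨x⟩).target) :
    (mfderivWithin 𝓘(ℝ, Direction V) 𝓘(ℝ, Direction V) (extChartAt 𝓘(ℝ, Direction V) x).symm
      (Set.range 𝓘(ℝ, Direction V)) v : Direction V →L[ℝ] Direction V) = .id ℝ (Direction V) := by
  have h : HasMFDerivAt 𝓘(ℝ, Direction V) 𝓘(ℝ, Direction V) (chart s V ⟨x⟩).symm v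
      (ContinuousLinearMap.id ℝ (Direction V)) := by
    refine ⟨(chart s V ⟨x⟩).continuousOn_symm.continuousAt
      ((chart s V ⟨x⟩).open_target.mem_nhds hv), ?_⟩
    have h1 : HasFDerivAt (coord s V ∘ (chart s V ⟨x⟩).symm)
        (ContinuousLinearMap.id ℝ (Direction V)) v := by
      refine (hasFDerivAt_id v).congr_of_eventuallyEq ?_
      filter_upwards [(chart s V ⟨x⟩).open_target.mem_nhds hv] with w hw
      exact coord_chart_symm _ hw
    exact h1.hasFDerivWithinAt
  have h2 : mfderiv 𝓘(ℝ, Direction V) 𝓘(ℝ, Direction V) (extChartAt 𝓘(ℝ, Direction V) x).symm v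
    = ContinuousLinearMap.id ℝ (Direction V) := h.mfderiv
  rw [ModelWithCorners.range_eq_univ, mfderivWithin_univ]
  exact h2

theorem lieBracketWithin_eq_zero_of_eventuallyEq_const {F G : W → W} {x v w : W}
    (hF : F =ᶠ[𝓝 x] fun _ => v) (hG : G =ᶠ[𝓝 x] fun _ => w) (t : Set W) :
    VectorField.lieBracketWithin ℝ F G t x = 0 := by
  rw [(hF.filter_mono nhdsWithin_le_nhds).lieBracketWithin_vectorField_eq hF.self_of_nhds
    (hG.filter_mono nhdsWithin_le_nhds) hG.self_of_nhds]
  simp [VectorField.lieBracketWithin]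

/-- Constant vector fields are the coordinate fields of the global chart, so they commute. -/
theorem mlieBracket_const (x : s) (v w : Direction V) :
    VectorField.mlieBracket 𝓘(ℝ, Direction V) (constField (s := s) v)
      (constField (s := s) w) x = 0 := by
  have key : ∀ u : Direction V, VectorField.mpullbackWithin 𝓘(ℝ, Direction V) 𝓘(ℝ, Direction V)
      (extChartAt 𝓘(ℝ, Direction V) x).symm (constField (s := s) u)
      (Set.range 𝓘(ℝ, Direction V)) =ᶠ[𝓝 (coord s V x)] fun _ => u := by
    intro u
    filter_upwards [target_mem_nhds ⟨x⟩ x] with y hy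
    have h := mfderivWithin_chart_symm x hy
    rw [VectorField.mpullbackWithin_apply]
    exact (congrArg (fun A : Direction V →L[ℝ] Direction V => A.inverse u) h).trans (by simp)
  rw [← VectorField.mlieBracketWithin_univ, VectorField.mlieBracketWithin_apply]
  have h1 := lieBracketWithin_eq_zero_of_eventuallyEq_const (key v) (key w)
    ((extChartAt 𝓘(ℝ, Direction V) x).symm ⁻¹' Set.univ ∩ Set.range 𝓘(ℝ, Direction V))
  exact (congrArg _ h1).trans (map_zero _)

end AffineOpen

/-! ### Uniqueness of the Levi-Civita connection -/

section Riemannian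
variable {E : Type} [NormedAddCommGroup E] [NormedSpace ℝ E] [FiniteDimensional ℝ E]
  {H : Type} [TopologicalSpace H] {I : ModelWithCorners ℝ E H}
  {M : Type} [TopologicalSpace M] [ChartedSpace H M] [IsManifold I ∞ M]

/-- Metric compatibility with the inner products of `g` written out. -/
theorem isLeviCivita_iff_inner
    (g : Bundle.ContMDiffRiemannianMetric I ∞ E (fun x : M => TangentSpace I x))
    (cov : CovariantDerivative I E (fun x : M => TangentSpace I x))
    [IsManifold I 2 M] [CompleteSpace E] :
    IsLeviCivita g cov ↔
      (∀ (x : M) (σ τ : ∀ y : M, TangentSpace I y),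
        MDifferentiableAt I (I.prod 𝓘(ℝ, E))
          (fun y => (Bundle.TotalSpace.mk' E y (σ y) : TangentBundle I M)) x →
        MDifferentiableAt I (I.prod 𝓘(ℝ, E))
          (fun y => (Bundle.TotalSpace.mk' E y (τ y) : TangentBundle I M)) x →
        ∀ ξ : TangentSpace I x, mvfderiv I (fun y => g.inner y (σ y) (τ y)) x ξ =
          g.inner x (cov σ x ξ) (τ x) + g.inner x (σ x) (cov τ x ξ)) ∧ cov.torsion = 0 := by
  classical
  let _ : Bundle.RiemannianBundle (fun x : M => TangentSpace I x) := ⟨g.toRiemannianMetric⟩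
  refine and_congr_left fun _ => ?_
  constructor
  · intro h x σ τ hσ hτ ξ
    -- The identity only involves the value `ξ` at `x` of the field along which one differentiates.
    have := h.mvfderiv_inner_eq (Function.update 0 x ξ) hσ hτ
    simp only [Function.update_self] at this
    exact this
  · intro h
    refine (CovariantDerivative.isMetricCompatible_iff _).2 ?_
    intro x X σ τ _ hσ hτ
    exact h x σ τ hσ hτ (X x)

end Riemannian

namespace AffineOpen
variable {E : Type} [NormedAddCommGroup E] [NormedSpace ℝ E] {s : Set E} {V : Submodule ℝ E}
  [AffineOpen s V]

theorem components_constField (v : Direction V) :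
    components (constField (s := s) v) = fun _ => v := rfl

theorem contMDiffAt_constField (v : Direction V) (x : s) (n : ℕ∞ω) :
    ContMDiffAt 𝓘(ℝ, Direction V) (𝓘(ℝ, Direction V).prod 𝓘(ℝ, Direction V)) n
      (fun y => (Bundle.TotalSpace.mk' (Direction V) y (constField v y) :
        TangentBundle 𝓘(ℝ, Direction V) s)) x := by
  rw [contMDiffAt_field_iff, components_constField]
  exact contMDiffAt_const

theorem diffFieldAt_constField (v : Direction V) (x : s) : DiffFieldAt (constField v) x :=
  (contMDiffAt_constField v x 1).mdifferentiableAt one_ne_zero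

/-- The torsion is a tensor, so it may be computed on constant vector fields, whose Lie bracket
vanishes. -/
theorem torsion_eq_zero_iff [FiniteDimensional ℝ E]
    (cov : CovariantDerivative 𝓘(ℝ, Direction V) (Direction V)
      (fun x : s => TangentSpace 𝓘(ℝ, Direction V) x)) :
    cov.torsion = 0 ↔ ∀ (x : s) (v w : TangentSpace 𝓘(ℝ, Direction V) x),
      cov (constField w) x v = cov (constField v) x w := by
  have h : ∀ (x : s) (v w : TangentSpace 𝓘(ℝ, Direction V) x), cov.torsion x v w =
      cov (constField w) x v - cov (constField v) x w := by
    intro x v w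
    have h1 := cov.torsion_apply (diffFieldAt_constField v x) (diffFieldAt_constField w x)
    exact h1.trans ((congrArg _ (mlieBracket_const x v w)).trans (sub_zero _))
  constructor
  · intro h0 x v w
    have := h x v w
    rw [h0] at this
    exact sub_eq_zero.1 this.symm
  · intro h0
    ext x v w
    rw [h, h0, sub_self]; rfl

/-- Two Levi-Civita connections agree on differentiable fields: their difference is a tensor that is
symmetric in its two arguments and whose values are skew-symmetric for `g`, hence zero. On fields that
are not differentiable a connection is unconstrained. -/
theorem isLeviCivita_unique [FiniteDimensional ℝ E]
    (g : Bundle.ContMDiffRiemannianMetric 𝓘(ℝ, Direction V) ∞ (Direction V)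
      (fun x : s => TangentSpace 𝓘(ℝ, Direction V) x))
    (cov cov' : CovariantDerivative 𝓘(ℝ, Direction V) (Direction V)
      (fun x : s => TangentSpace 𝓘(ℝ, Direction V) x))
    (h : IsLeviCivita g cov) (h' : IsLeviCivita g cov') (x : s) (η : VectorField s V)
    (hη : DiffFieldAt η x) : cov η x = cov' η x := by
  obtain ⟨hm, ht⟩ := (isLeviCivita_iff_inner g cov).1 h
  obtain ⟨hm', ht'⟩ := (isLeviCivita_iff_inner g cov').1 h'
  rw [torsion_eq_zero_iff] at ht ht'
  set A := cov.difference cov' x with hA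
  have hA' : ∀ σ : VectorField s V, DiffFieldAt σ x → A (σ x) = cov σ x - cov' σ x := fun σ hσ =>
    IsCovariantDerivativeOn.difference_apply _ _ (Set.mem_univ x) hσ
  have hc : ∀ v : TangentSpace 𝓘(ℝ, Direction V) x,
      A v = cov (constField v) x - cov' (constField v) x := fun v => hA' (constField v) (diffFieldAt_constField v x)
  have hsym : ∀ v w, A v w = A w v := by
    intro v w
    rw [hc, hc, sub_apply, sub_apply, ht, ht']
  have hskew : ∀ u v w, g.inner x (A v u) w = - g.inner x (A w u) v := by
    intro u v w
    have h1 := hm x (constField v) (constField w) (diffFieldAt_constField v x)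
      (diffFieldAt_constField w x) u
    have h2 := hm' x (constField v) (constField w) (diffFieldAt_constField v x)
      (diffFieldAt_constField w x) u
    rw [h1] at h2
    have h3 : ∀ c : CovariantDerivative 𝓘(ℝ, Direction V) (Direction V)
      (fun x : s => TangentSpace 𝓘(ℝ, Direction V) x),
        g.inner x (constField v x) (c (constField w) x u) =
          g.inner x (c (constField w) x u) v := fun c => g.symm x _ _
    rw [h3, h3] at h2
    rw [hc, hc, sub_apply, sub_apply, map_sub, map_sub, sub_apply, sub_apply]
    have h4 : constField (s := s) w x = w := rfl
    rw [h4] at h2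
    linear_combination h2
  have hzero : ∀ v w, A v w = 0 := by
    intro v w
    by_contra hne
    have h1 := g.pos x _ hne
    have key : ∀ u v w, g.inner x (A v u) w = 0 := by
      intro u v w
      -- Alternating the two symmetries along a 3-cycle gives `t = -t`.
      have e1 := hskew u v w
      have e2 := hskew w u v
      have e3 := hskew v w u
      rw [hsym w u] at e1
      rw [hsym v w] at e2
      rw [hsym u v] at e3
      linarith
    rw [key] at h1
    exact lt_irrefl _ h1
  have := hA' η hη
  ext u
  have h2 := congrArg (fun L => L u) this
  simp only [hzero, sub_apply] at h2
  exact sub_eq_zero.1 h2.symm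

end AffineOpen

/-! ### Projections with respect to a bilinear form -/

namespace AffineOpen
variable {E : Type} [NormedAddCommGroup E] [NormedSpace ℝ E]

/-- The projection onto `V` that is orthogonal for the bilinear form `B`: `z` goes to the vector of
`V` that represents `B z` on `V`. If the restriction of `B` to `V` is degenerate, its `inverse` and
the projection are zero by convention. -/
def formProj (V : Submodule ℝ E) (B : E →L[ℝ] E →L[ℝ] ℝ) : E →L[ℝ] Direction V :=
  (restrictForm V B).inverse.comp ((ContinuousLinearMap.precomp ℝ (incl V)).comp B)

theorem restrictForm_apply (V : Submodule ℝ E) (B : E →L[ℝ] E →L[ℝ] ℝ) (v w : Direction V) :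
    restrictForm V B v w = B (incl V v) (incl V w) := rfl

section proj
variable {V : Submodule ℝ E} {B : E →L[ℝ] E →L[ℝ] ℝ}

theorem eq_of_form_eq (hp : ∀ v ∈ V, v ≠ 0 → 0 < B v v) {p q : E} (hpV : p ∈ V) (hq : q ∈ V)
    (h : ∀ w ∈ V, B p w = B q w) : p = q := by
  by_contra hne
  have h1 := hp _ (V.sub_mem hpV hq) (sub_ne_zero.2 hne)
  rw [map_sub B, sub_apply, h _ (V.sub_mem hpV hq), sub_self] at h1
  exact lt_irrefl _ h1

variable [FiniteDimensional ℝ E]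

theorem exists_equiv_restrictForm (hp : ∀ v ∈ V, v ≠ 0 → 0 < B v v) :
    ∃ e : Direction V ≃L[ℝ] (Direction V →L[ℝ] ℝ),
      (e : Direction V →L[ℝ] (Direction V →L[ℝ] ℝ)) = restrictForm V B := by
  have hinj : Function.Injective (restrictForm V B : Direction V →ₗ[ℝ] (Direction V →L[ℝ] ℝ)) := by
    rw [← LinearMap.ker_eq_bot, LinearMap.ker_eq_bot']
    intro v hv
    by_contra hne
    have h1 := hp _ (incl_mem V v) fun h => hne (incl_injective V (h.trans (map_zero _).symm))
    have h2 : restrictForm V B v v = 0 := by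
      have : restrictForm V B v = 0 := hv
      rw [this]; rfl
    rw [restrictForm_apply] at h2
    exact h1.ne' h2
  have hdim : Module.finrank ℝ (Direction V) = Module.finrank ℝ (Direction V →L[ℝ] ℝ) := by
    rw [(LinearMap.toContinuousLinearMap : (Direction V →ₗ[ℝ] ℝ) ≃ₗ[ℝ] _).symm.finrank_eq]
    exact (Subspace.dual_finrank_eq (K := ℝ) (V := Direction V)).symm
  refine ⟨(LinearEquiv.ofInjectiveOfFinrankEq _ hinj hdim).toContinuousLinearEquiv, ?_⟩
  ext v w
  rfl

theorem formProj_spec (hp : ∀ v ∈ V, v ≠ 0 → 0 < B v v) (z w : E) (hw : w ∈ V) :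
    B (incl V (formProj V B z)) w = B z w := by
  obtain ⟨e, he⟩ := exists_equiv_restrictForm hp
  have h1 : restrictForm V B (formProj V B z) = (B z).comp (incl V) := by
    rw [formProj, ← he, ContinuousLinearMap.inverse_equiv]
    exact e.apply_symm_apply _
  exact congrArg (fun L => L (Direction.mk V w hw)) h1

theorem incl_formProj_eq (hp : ∀ v ∈ V, v ≠ 0 → 0 < B v v) {z p : E} (hpV : p ∈ V)
    (h : ∀ w ∈ V, B p w = B z w) : incl V (formProj V B z) = p :=
  eq_of_form_eq hp (incl_mem V _) hpV fun w hw => (formProj_spec hp z w hw).trans (h w hw).symm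

theorem incl_formProj_of_mem (hp : ∀ v ∈ V, v ≠ 0 → 0 < B v v) {z : E} (hz : z ∈ V) :
    incl V (formProj V B z) = z := incl_formProj_eq hp hz fun _ _ => rfl

set_option synthInstance.maxHeartbeats 400000 in
theorem contDiffAt_inverse_restrictForm {F : Type} [NormedAddCommGroup F] [NormedSpace ℝ F]
    {C : F → E →L[ℝ] E →L[ℝ] ℝ} {x : F} (hC : ContDiffAt ℝ ∞ C x)
    (hp : ∀ v ∈ V, v ≠ 0 → 0 < C x v v) :
    ContDiffAt ℝ ∞ (fun y => (restrictForm V (C y)).inverse) x := by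
  obtain ⟨e, he⟩ := exists_equiv_restrictForm hp
  have h1 : ContDiffAt ℝ ∞ ContinuousLinearMap.inverse (restrictForm V (C x)) := by
    rw [← he]; exact contDiffAt_map_inverse e
  have h2 : ContDiff ℝ ∞ (restrictForm (E := E) V) := ContinuousLinearMap.contDiff _
  exact h1.comp x (h2.contDiffAt.comp x hC)

set_option synthInstance.maxHeartbeats 400000 in
theorem contDiffAt_formProj {F : Type} [NormedAddCommGroup F] [NormedSpace ℝ F]
    {C : F → E →L[ℝ] E →L[ℝ] ℝ} {x : F} (hC : ContDiffAt ℝ ∞ C x)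
    (hp : ∀ v ∈ V, v ≠ 0 → 0 < C x v v) : ContDiffAt ℝ ∞ (fun y => formProj V (C y)) x := by
  have h2 : ContDiffAt ℝ ∞ (fun y => (ContinuousLinearMap.precomp ℝ (incl V)).comp (C y)) x :=
    ContDiffAt.clm_comp contDiffAt_const hC
  exact ContDiffAt.clm_comp (contDiffAt_inverse_restrictForm hC hp) h2

end proj

/-! ### Existence of the Levi-Civita connection -/

variable {s : Set E} {V : Submodule ℝ E} [AffineOpen s V]

/-- The flat connection of the affine space: `∇_ξ η` is the directional derivative. -/
def flatConnection [FiniteDimensional ℝ E] : CovariantDerivative 𝓘(ℝ, Direction V) (Direction V)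
      (fun x : s => TangentSpace 𝓘(ℝ, Direction V) x) where
  toFun η x := modelDeriv (components η) x
  isCovariantDerivativeOnUniv := by
    constructor
    · intro σ σ' x hσ hσ' _
      exact mvfderiv_add (diffFieldAt_iff.1 hσ) (diffFieldAt_iff.1 hσ')
    · intro σ g x hσ hg _
      exact mvfderiv_smul hg (diffFieldAt_iff.1 hσ)

theorem incl_modelDeriv (η : VectorField s V) {x : s} (hη : DiffFieldAt η x)
    (ξ : TangentSpace 𝓘(ℝ, Direction V) x) :
    incl V (modelDeriv (components η) x ξ) = dirDeriv η x ξ := by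
  have h := (incl V).hasFDerivAt.comp _ (hasFDerivAt_modelDeriv (diffFieldAt_iff.1 hη))
  have h2 := modelDeriv_eq (g := fun y : s => emb y (η y)) h
  exact (congrArg (fun L => L ξ) h2).symm

theorem hasFDerivAt_comp_val {W : Type} [NormedAddCommGroup W] [NormedSpace ℝ W] {F : E → W} {x : s}
    (hF : DifferentiableAt ℝ F x) :
    HasFDerivAt ((fun y : s => F y) ∘ (chart s V ⟨x⟩).symm) ((fderiv ℝ F x).comp (incl V))
      (coord s V x) := by
  have h1 : HasFDerivAt (fun v : Direction V => base s V + incl V v) (incl V) (coord s V x) :=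
    (incl V).hasFDerivAt.const_add _
  have h2 : HasFDerivAt F (fderiv ℝ F x) (base s V + incl V (coord s V x)) := by
    rw [base_add_incl_coord]; exact hF.hasFDerivAt
  refine (h2.comp (coord s V x) h1).congr_of_eventuallyEq ?_
  filter_upwards [target_mem_nhds ⟨x⟩ x] with v hv
  exact congrArg F (val_chart_symm _ hv)

theorem mvfderiv_comp_val {F : E → ℝ} {x : s} (hF : DifferentiableAt ℝ F x)
    (ξ : TangentSpace 𝓘(ℝ, Direction V) x) :
    mvfderiv 𝓘(ℝ, Direction V) (fun y : s => F y) x ξ = fderiv ℝ F x (emb x ξ) :=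
  congrArg (fun L => L ξ) (modelDeriv_eq (hasFDerivAt_comp_val hF))

theorem contMDiff_comp_val {W : Type} [NormedAddCommGroup W] [NormedSpace ℝ W] {F : E → W}
    (hF : ∀ x ∈ s, ContDiffAt ℝ ∞ F x) :
    ContMDiff 𝓘(ℝ, Direction V) 𝓘(ℝ, W) ∞ (fun y : s => F y) := fun x =>
  (hF x x.2).contMDiffAt.comp x (contMDiff_val s V ∞ x)

theorem dirDeriv_mem (η : VectorField s V) {x : s} (hη : DiffFieldAt η x)
    (ξ : TangentSpace 𝓘(ℝ, Direction V) x) : dirDeriv η x ξ ∈ V := by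
  rw [← incl_modelDeriv η hη]
  exact incl_mem V _

/-- The product rule for a position-dependent bilinear form of two vector fields. -/
theorem mvfderiv_form {B : E → E →L[ℝ] E →L[ℝ] ℝ} {x : s} (hB : DifferentiableAt ℝ B x)
    {σ τ : VectorField s V} (hσ : DiffFieldAt σ x) (hτ : DiffFieldAt τ x)
    (ξ : TangentSpace 𝓘(ℝ, Direction V) x) :
    mvfderiv 𝓘(ℝ, Direction V) (fun y : s => B y (emb y (σ y)) (emb y (τ y))) x ξ =
      fderiv ℝ B x (emb x ξ) (emb x (σ x)) (emb x (τ x)) +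
        B x (dirDeriv σ x ξ) (emb x (τ x)) + B x (emb x (σ x)) (dirDeriv τ x ξ) := by
  have hB' := hasFDerivAt_comp_val (s := s) (V := V) (x := x) (W := E →L[ℝ] E →L[ℝ] ℝ) hB
  have h0 := hB'.clm_apply
    ((incl V).hasFDerivAt.comp _ (hasFDerivAt_modelDeriv (diffFieldAt_iff.1 hσ)))
  have h1 := h0.clm_apply
    ((incl V).hasFDerivAt.comp _ (hasFDerivAt_modelDeriv (diffFieldAt_iff.1 hτ)))
  simp only [Function.comp_apply, chart_symm_coord] at h1
  have h2 := modelDeriv_eq (g := fun y : s => B y (emb y (σ y)) (emb y (τ y))) h1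
  have h3 : ∀ v : Direction V, modelDeriv (fun y : s => B y (emb y (σ y)) (emb y (τ y))) x v =
      fderiv ℝ B x (incl V v) (incl V (components σ x)) (incl V (components τ x)) +
        B x (incl V (modelDeriv (components σ) x v)) (incl V (components τ x)) +
        B x (incl V (components σ x)) (incl V (modelDeriv (components τ) x v)) := by
    intro v
    rw [h2]
    simp only [add_apply, ContinuousLinearMap.comp_apply, ContinuousLinearMap.flip_apply]
    ring
  rw [← incl_modelDeriv σ hσ, ← incl_modelDeriv τ hτ]
  exact h3 ξ


theorem modelDeriv_constField (u : Direction V) (x : s) :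
    modelDeriv (V := V) (components (s := s) (V := V) (constField u)) x = 0 := by
  rw [components_constField]
  exact modelDeriv_eq (hasFDerivAt_const u _)

/-- The vector-valued bilinear form `G` on the ambient space, restricted to `V` and projected
to `V`. -/
def projForm (V : Submodule ℝ E) (B : E →L[ℝ] E →L[ℝ] ℝ) (G : E →L[ℝ] E →L[ℝ] E) :
    Direction V →L[ℝ] Direction V →L[ℝ] Direction V :=
  (ContinuousLinearMap.compL ℝ (Direction V) E (Direction V) (formProj V B)).comp
    ((ContinuousLinearMap.precomp E (incl V)).comp (G.comp (incl V)))

section levicivita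
variable [FiniteDimensional ℝ E]

/-- The connection `∇_ξ η = Dη[ξ] - Π (G (η, ξ))`, with `Π` the orthogonal projection onto `V`. The
order of the arguments of `G` does not matter below, as `G` is symmetric on `V`. -/
def projConnection (B : E → E →L[ℝ] E →L[ℝ] ℝ) (G : E → E →L[ℝ] E →L[ℝ] E) :
    CovariantDerivative 𝓘(ℝ, Direction V) (Direction V)
      (fun x : s => TangentSpace 𝓘(ℝ, Direction V) x) :=
  flatConnection.addOneForm fun x => -projForm V (B x) (G x)

variable {B : E → E →L[ℝ] E →L[ℝ] ℝ} {G : E → E →L[ℝ] E →L[ℝ] E}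

theorem projConnection_apply (η : VectorField s V) (x : s)
    (ξ : TangentSpace 𝓘(ℝ, Direction V) x) :
    projConnection B G η x ξ = modelDeriv (components η) x ξ -
      formProj V (B x) (G x (emb x (η x)) (emb x ξ)) :=
  (sub_eq_add_neg _ _).symm

theorem emb_projConnection_apply {x : s}
    (hp : ∀ v ∈ V, v ≠ 0 → 0 < B x v v) (hG : ∀ ξ ∈ V, ∀ η ∈ V, G x ξ η = G x η ξ)
    (η : VectorField s V) (hη : DiffFieldAt η x) (ξ : TangentSpace 𝓘(ℝ, Direction V) x) :
    emb x (projConnection B G η x ξ) =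
      incl V (formProj V (B x) (dirDeriv η x ξ - G x (emb x ξ) (emb x (η x)))) := by
  rw [projConnection_apply, hG _ (emb_mem x _) _ (emb_mem x _), map_sub, map_sub,
    ← incl_modelDeriv η hη, incl_formProj_of_mem hp (incl_mem V _)]
  exact map_sub (incl V) _ _

/-- The connection is metric if the derivative of `B` is minus the symmetrized `G`, and torsion free
if `G` is symmetric. -/
theorem isLeviCivita_projConnection (hs : ∀ x ∈ s, ∀ v ∈ V, ∀ w ∈ V, B x v w = B x w v)
    (hp : ∀ x ∈ s, ∀ v ∈ V, v ≠ 0 → 0 < B x v v) (hB : ∀ x ∈ s, ContDiffAt ℝ ∞ B x)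
    (hG : ∀ x ∈ s, ∀ ξ ∈ V, ∀ η ∈ V, G x ξ η = G x η ξ)
    (hBG : ∀ x ∈ s, ∀ ξ ∈ V, ∀ η ∈ V, ∀ ζ ∈ V,
      fderiv ℝ B x ξ η ζ = -(B x (G x ξ η) ζ + B x (G x ξ ζ) η)) :
    IsLeviCivita (metric s V B hs hp hB) (projConnection B G) := by
  refine (isLeviCivita_iff_inner _ _).2 ⟨?_, ?_⟩
  · intro x σ τ hσ hτ ξ
    have h1 : ∀ (η : VectorField s V) (hη : DiffFieldAt η x), ∀ w ∈ V,
        B x (emb x (projConnection B G η x ξ)) w =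
          B x (dirDeriv η x ξ) w - B x (G x (emb x ξ) (emb x (η x))) w := by
      intro η hη w hw
      rw [emb_projConnection_apply (hp x x.2) (hG x x.2) η hη, formProj_spec (hp x x.2) _ _ hw,
        map_sub, sub_apply]
    refine (mvfderiv_form ((hB x x.2).differentiableAt (by simp)) hσ hτ ξ).trans ?_
    change _ = B x (emb x (projConnection B G σ x ξ)) (emb x (τ x)) +
      B x (emb x (σ x)) (emb x (projConnection B G τ x ξ))
    rw [hs x x.2 (emb x (σ x)) (emb_mem x _) (emb x (projConnection B G τ x ξ)) (emb_mem x _),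
      h1 σ hσ _ (emb_mem x _), h1 τ hτ _ (emb_mem x _),
      hBG x x.2 _ (emb_mem x ξ) _ (emb_mem x (σ x)) _ (emb_mem x (τ x)),
      hs x x.2 (emb x (σ x)) (emb_mem x _) (dirDeriv τ x ξ) (dirDeriv_mem τ hτ ξ)]
    ring
  · rw [torsion_eq_zero_iff]
    intro x
    have h : ∀ v w : Direction V, projConnection B G (constField w) x (ofModel x v) =
        projConnection B G (constField v) x (ofModel x w) := by
      intro v w
      rw [projConnection_apply, projConnection_apply, hG x x.2 _ (emb_mem x _) _ (emb_mem x _),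
        modelDeriv_constField, modelDeriv_constField]
      rfl
    exact h

theorem contMDiff_projConnection (hp : ∀ x ∈ s, ∀ v ∈ V, v ≠ 0 → 0 < B x v v)
    (hB : ∀ x ∈ s, ContDiffAt ℝ ∞ B x) (hG : ∀ x ∈ s, ContDiffAt ℝ ∞ G x) :
    CovariantDerivative.ContMDiffCovariantDerivative (projConnection (s := s) (V := V) B G) ∞ := by
  refine ⟨⟨fun {σ} hσ => ?_⟩⟩
  rw [contMDiffOn_univ] at hσ ⊢
  have hσ' : ContMDiff 𝓘(ℝ, Direction V) 𝓘(ℝ, Direction V) ∞ (components σ) := fun x =>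
    contMDiffAt_field_iff.1 ((hσ x).of_le (by simp))
  have h1 := contMDiff_modelDeriv hσ'
  have h2 : ContMDiff 𝓘(ℝ, Direction V) 𝓘(ℝ, Direction V →L[ℝ] Direction V →L[ℝ] Direction V) ∞
      (fun y : s => projForm V (B y) (G y)) := by
    refine contMDiff_comp_val (F := fun y => projForm V (B y) (G y)) fun x hx => ?_
    exact (contDiffAt_const.clm_apply (contDiffAt_formProj (hB x hx) (hp x hx))).clm_comp
      (contDiffAt_const.clm_comp ((hG x hx).clm_comp contDiffAt_const))
  have h3 := h1.sub (h2.clm_apply hσ')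
  intro x
  rw [contMDiffAt_hom_bundle]
  refine ⟨contMDiffAt_id, (h3 x).congr_of_eventuallyEq (Filter.Eventually.of_forall fun y => ?_)⟩
  refine (inCoordinates_eq x y _).trans ?_
  exact (sub_eq_add_neg _ _).symm

end levicivita
end AffineOpen

/-! ### Gradients and Hessians -/

section Riemannian
variable {E : Type} [NormedAddCommGroup E] [NormedSpace ℝ E] [FiniteDimensional ℝ E]
  {H : Type} [TopologicalSpace H] {I : ModelWithCorners ℝ E H}
  {M : Type} [TopologicalSpace M] [ChartedSpace H M] [IsManifold I ∞ M]

/-- Metric compatibility applied to `Y f = g (grad f, Y)`. -/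
theorem isHessianAt_cov_gradient [IsManifold I 2 M] [CompleteSpace E]
    {g : Bundle.ContMDiffRiemannianMetric I ∞ E (fun x : M => TangentSpace I x)}
    {cov : CovariantDerivative I E (fun x : M => TangentSpace I x)} (h : IsLeviCivita g cov)
    {f : M → ℝ} {x : M}
    (hf : MDifferentiableAt I (I.prod 𝓘(ℝ, E)) (fun y =>
      (Bundle.TotalSpace.mk' E y (riemannianGradient g f y) : TangentBundle I M)) x) :
    IsHessianAt g cov f x (cov (riemannianGradient g f) x) := by
  intro ξ Y hY
  have h1 := ((isLeviCivita_iff_inner g cov).1 h).1 x (riemannianGradient g f) Y hf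
    ((hY x).mdifferentiableAt (by simp)) ξ
  simp only [inner_riemannianGradient] at h1
  linear_combination -h1

end Riemannian

namespace AffineOpen
variable {E : Type} [NormedAddCommGroup E] [NormedSpace ℝ E]
  {s : Set E} {V : Submodule ℝ E} [AffineOpen s V]

/-- Every tangent vector extends to a smooth field, here a constant one, so the defining identity
determines the Hessian. -/
theorem isHessianAt_unique [FiniteDimensional ℝ E]
    {g : Bundle.ContMDiffRiemannianMetric 𝓘(ℝ, Direction V) ∞ (Direction V)
      (fun x : s => TangentSpace 𝓘(ℝ, Direction V) x)}
    {cov : CovariantDerivative 𝓘(ℝ, Direction V) (Direction V)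
      (fun x : s => TangentSpace 𝓘(ℝ, Direction V) x)} {f : s → ℝ} {x : s}
    {A A' : TangentSpace 𝓘(ℝ, Direction V) x →L[ℝ] TangentSpace 𝓘(ℝ, Direction V) x}
    (hA : IsHessianAt g cov f x A) (hA' : IsHessianAt g cov f x A') : A = A' := by
  ext ξ
  have h : ∀ w : TangentSpace 𝓘(ℝ, Direction V) x, g.inner x (A ξ) w = g.inner x (A' ξ) w :=
    fun w => (hA ξ (constField w) (fun y => contMDiffAt_constField w y ∞)).trans
      (hA' ξ (constField w) (fun y => contMDiffAt_constField w y ∞)).symm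
  by_contra hne
  have h1 := g.pos x (A ξ - A' ξ) (sub_ne_zero.2 hne)
  rw [map_sub (g.inner x), sub_apply, h, sub_self] at h1
  exact lt_irrefl _ h1

section metric
variable [FiniteDimensional ℝ E] {B : E → E →L[ℝ] E →L[ℝ] ℝ} {G : E → E →L[ℝ] E →L[ℝ] E}
  {hs : ∀ x ∈ s, ∀ v ∈ V, ∀ w ∈ V, B x v w = B x w v}
  {hp : ∀ x ∈ s, ∀ v ∈ V, v ≠ 0 → 0 < B x v v} {hB : ∀ x ∈ s, ContDiffAt ℝ ∞ B x}

/-- Any Levi-Civita connection agrees with `projConnection` on differentiable vector fields. -/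
theorem emb_leviCivita_apply (hG : ∀ x ∈ s, ∀ ξ ∈ V, ∀ η ∈ V, G x ξ η = G x η ξ)
    (hBG : ∀ x ∈ s, ∀ ξ ∈ V, ∀ η ∈ V, ∀ ζ ∈ V,
      fderiv ℝ B x ξ η ζ = -(B x (G x ξ η) ζ + B x (G x ξ ζ) η))
    {cov : CovariantDerivative 𝓘(ℝ, Direction V) (Direction V)
      (fun x : s => TangentSpace 𝓘(ℝ, Direction V) x)}
    (h : IsLeviCivita (metric s V B hs hp hB) cov) {x : s} {η : VectorField s V}
    (hη : DiffFieldAt η x) (ξ : TangentSpace 𝓘(ℝ, Direction V) x) :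
    emb x (cov η x ξ) =
      incl V (formProj V (B x) (dirDeriv η x ξ - G x (emb x ξ) (emb x (η x)))) := by
  rw [isLeviCivita_unique _ _ _ h (isLeviCivita_projConnection hs hp hB hG hBG) x η hη]
  exact emb_projConnection_apply (hp x x.2) (hG x x.2) η hη ξ

theorem form_gradient_apply {F : E → ℝ} {x : s} (hF : DifferentiableAt ℝ F x) {w : E}
    (hw : w ∈ V) :
    B x (emb x (riemannianGradient (metric s V B hs hp hB) (fun y : s => F y) x)) w =
      fderiv ℝ F x w :=
  (inner_riemannianGradient (metric s V B hs hp hB) (fun y : s => F y) x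
    (ofModel x (Direction.mk V w hw))).trans (mvfderiv_comp_val hF _)

theorem diffFieldAt_gradient {F : E → ℝ} (hF : ∀ x ∈ s, ContDiffAt ℝ ∞ F x) (x : s) :
    DiffFieldAt (riemannianGradient (metric s V B hs hp hB) (fun y : s => F y)) x := by
  -- In coordinates the gradient is the differential, transformed by the inverse of the metric.
  have hcomp : components (riemannianGradient (metric s V B hs hp hB) (fun y : s => F y)) =
      fun y : s => (restrictForm V (B y)).inverse ((fderiv ℝ F y).comp (incl V)) := by
    funext y
    obtain ⟨e, he⟩ := exists_equiv_restrictForm (hp y y.2)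
    rw [← he, ContinuousLinearMap.inverse_equiv]
    refine (e.symm_apply_eq.2 ?_).symm
    ext w
    have h1 := form_gradient_apply (hs := hs) (hp := hp) (hB := hB)
      ((hF y y.2).differentiableAt (by simp)) (incl_mem V w)
    have h2 := congrArg (fun L => L (components (riemannianGradient (metric s V B hs hp hB)
      (fun y : s => F y)) y) w) he
    exact h1.symm.trans h2.symm
  have hsm : ContMDiff 𝓘(ℝ, Direction V) 𝓘(ℝ, Direction V) ∞ (fun y : s =>
      (restrictForm V (B y)).inverse ((fderiv ℝ F y).comp (incl V))) := by
    refine contMDiff_comp_val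
      (F := fun y => (restrictForm V (B y)).inverse ((fderiv ℝ F y).comp (incl V))) fun y hy => ?_
    exact (contDiffAt_inverse_restrictForm (hB y hy) (hp y hy)).clm_apply
      (((hF y hy).fderiv_right (m := ∞) (by simp)).clm_comp contDiffAt_const)
  rw [diffFieldAt_iff, hcomp]
  exact (hsm x).mdifferentiableAt (by simp)

end metric

/-! ### Nested affine open sets -/

/-- The directional derivative in `t` of an extension of the vector field `η` from `s ⊆ t`, along a
vector tangent to `s`, is that of `η`. -/
theorem dirDeriv_eq_of_extends {t : Set E} {U : Submodule ℝ E} [AffineOpen t U] (hVU : V ≤ U)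
    (ι : s → t) (hι : ∀ y, (ι y : E) = y) {x : s} {η : VectorField s V} {ζ : VectorField t U}
    (hζ : DiffFieldAt ζ (ι x)) (hext : ∀ y, emb (ι y) (ζ (ι y)) = emb y (η y))
    {ξ : TangentSpace 𝓘(ℝ, Direction V) x} {ξ' : TangentSpace 𝓘(ℝ, Direction U) (ι x)}
    (hξ : emb (ι x) ξ' = emb x ξ) : dirDeriv ζ (ι x) ξ' = dirDeriv η x ξ := by
  let j : Direction V →L[ℝ] Direction U := (incl V).codRestrict U fun v => hVU (incl_mem V v)
  have hj : ∀ v, incl U (j v) = incl V v := fun v => rfl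
  have h1 := (incl U).hasFDerivAt.comp _ (hasFDerivAt_modelDeriv (diffFieldAt_iff.1 hζ))
  -- In the charts the inclusion is the affine map with linear part `j`.
  have h2 : HasFDerivAt (fun v : Direction V => coord t U (ι x) + j (v - coord s V x)) j
      (coord s V x) :=
    (j.hasFDerivAt.comp (coord s V x) ((hasFDerivAt_id _).sub_const _)).const_add _
  have h3 : coord t U (ι x) + j (coord s V x - coord s V x) = coord t U (ι x) := by simp
  have h4 := (HasFDerivAt.comp (coord s V x) (by rw [h3]; exact h1) h2)
  have h5 : HasFDerivAt ((fun y : s => emb y (η y)) ∘ (chart s V ⟨x⟩).symm)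
      (((incl U).comp (modelDeriv (components ζ) (ι x))).comp j) (coord s V x) := by
    refine h4.congr_of_eventuallyEq ?_
    filter_upwards [target_mem_nhds ⟨x⟩ x] with v hv
    have h6 : coord t U (ι x) + j (v - coord s V x) =
        coord t U (ι ((chart s V ⟨x⟩).symm v)) := by
      apply incl_injective U
      have e1 := base_add_incl_coord t U (ι x)
      have e2 := base_add_incl_coord t U (ι ((chart s V ⟨x⟩).symm v))
      rw [hι, val_chart_symm _ hv] at e2
      rw [hι, ← base_add_incl_coord s V x] at e1
      rw [map_add, hj, map_sub, eq_sub_of_add_eq' e1, eq_sub_of_add_eq' e2]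
      abel
    have h7 : (chart t U ⟨ι x⟩).symm (coord t U (ι x) + j (v - coord s V x)) =
        ι ((chart s V ⟨x⟩).symm v) := by rw [h6, chart_symm_coord]
    have h8 := (hext ((chart s V ⟨x⟩).symm v)).symm
    change _ = incl U (components ζ ((chart t U ⟨ι x⟩).symm _))
    rw [h7]
    exact h8
  have h9 := modelDeriv_eq h5
  have h10 : dirDeriv η x ξ = incl U (modelDeriv (components ζ) (ι x) (j ξ)) :=
    congrArg (fun L => L ξ) h9
  have h11 : (j ξ : Direction U) = ξ' := incl_injective U hξ.symm
  rw [h10, h11, incl_modelDeriv ζ hζ]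

end AffineOpen

/-! ### The minimisation property of the projection -/

namespace AffineOpen
variable {E : Type} [NormedAddCommGroup E] [NormedSpace ℝ E]

/-- Completing the square: the projection onto `V` minimises `-B z ξ + B ξ ξ / 2`. -/
theorem isMin_iff_eq_formProj [FiniteDimensional ℝ E] {V : Submodule ℝ E} {B : E →L[ℝ] E →L[ℝ] ℝ}
    (hs : ∀ v ∈ V, ∀ w ∈ V, B v w = B w v) (hp : ∀ v ∈ V, v ≠ 0 → 0 < B v v) (z p : E) :
    (p ∈ V ∧ ∀ ξ ∈ V, -B z p + 1 / 2 * B p p ≤ -B z ξ + 1 / 2 * B ξ ξ) ↔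
      p = incl V (formProj V B z) := by
  set q := incl V (formProj V B z) with hq
  have hqV : q ∈ V := incl_mem V _
  have key : ∀ ξ ∈ V, -B z ξ + 1 / 2 * B ξ ξ = 1 / 2 * B (ξ - q) (ξ - q) - 1 / 2 * B q q := by
    intro ξ hξ
    rw [← formProj_spec hp z ξ hξ, ← hq]
    simp only [map_sub, sub_apply]
    rw [hs ξ hξ q hqV]
    ring
  constructor
  · rintro ⟨hpV, hmin⟩
    by_contra hne
    have h1 := hmin q hqV
    have h2 := hp _ (V.sub_mem hpV hqV) (sub_ne_zero.2 hne)
    rw [key p hpV, key q hqV, sub_self, map_zero] at h1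
    linarith
  · rintro rfl
    refine ⟨hqV, fun ξ hξ => ?_⟩
    rw [key ξ hξ, key _ hqV, sub_self, map_zero]
    have : 0 ≤ B (ξ - q) (ξ - q) := by
      rcases eq_or_ne (ξ - q) 0 with h | h
      · rw [h, map_zero]
      · exact (hp _ (V.sub_mem hξ hqV) h).le
    linarith

end AffineOpen

/-! ### Symmetric parts of matrices -/

section matrix
variable {n K : ℕ}

theorem isSymm_mat_of_mem {x : MatTuple n K} (hx : x ∈ spdProduct n K) (i : Fin K) :
    (x.mat i).IsSymm := by simpa [Matrix.IsSymm, Matrix.IsHermitian] using (hx i).1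

theorem symPart_of_isSymm {A : Matrix (Fin n) (Fin n) ℝ} (hA : A.IsSymm) : symPart A = A := by
  rw [symPart, hA.eq, ← two_smul ℝ A, smul_smul]
  norm_num

theorem isSymm_symPart (A : Matrix (Fin n) (Fin n) ℝ) : (symPart A).IsSymm := by
  rw [symPart, Matrix.IsSymm, Matrix.transpose_smul, Matrix.transpose_add,
    Matrix.transpose_transpose, add_comm]

theorem trace_symPart_mul {A w : Matrix (Fin n) (Fin n) ℝ} (hw : w.IsSymm) :
    (symPart A * w).trace = (Aᵀ * w).trace := by
  have h : (A * w).trace = (Aᵀ * w).trace := by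
    rw [← Matrix.trace_transpose, Matrix.transpose_mul, hw.eq, Matrix.trace_mul_comm]
  rw [symPart, Matrix.smul_mul, Matrix.add_mul, Matrix.trace_smul, Matrix.trace_add, h, smul_eq_mul]
  ring

/-! ### The derivative of the inverse -/

set_option synthInstance.maxHeartbeats 400000 in
/-- A normed algebra version of the derivative of `X ↦ tr (X⁻¹ η X⁻¹ ζ)`, from
`d (X⁻¹) = -X⁻¹ (dX) X⁻¹`. -/
theorem hasDerivAt_ringInverse_form {R : Type} [NormedRing R] [NormedAlgebra ℝ R] [CompleteSpace R]
    [FiniteDimensional ℝ R] (τ : R →ₗ[ℝ] ℝ) (u : Rˣ) (ξ η ζ : R) :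
    HasDerivAt (fun t : ℝ => τ (Ring.inverse (u + t • ξ) * η * Ring.inverse (u + t • ξ) * ζ))
      (-(τ (↑u⁻¹ * ξ * ↑u⁻¹ * η * ↑u⁻¹ * ζ) + τ (↑u⁻¹ * η * ↑u⁻¹ * ξ * ↑u⁻¹ * ζ))) 0 := by
  have h1 : HasDerivAt (fun t : ℝ => (u : R) + t • ξ) ξ 0 := by
    simpa using! ((hasDerivAt_id (0 : ℝ)).smul_const ξ).const_add (u : R)
  have h2 : HasDerivAt (fun t : ℝ => Ring.inverse ((u : R) + t • ξ)) (-(↑u⁻¹ * ξ * ↑u⁻¹)) 0 := by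
    have h3 := hasFDerivAt_ringInverse (𝕜 := ℝ) u
    have h4 : (u : R) = u + (0 : ℝ) • ξ := by simp
    rw [h4] at h3
    simpa using! h3.comp_hasDerivAt (0 : ℝ) h1
  have h5 := ((h2.mul_const η).mul h2).mul_const ζ
  have h6 := τ.toContinuousLinearMap.hasFDerivAt.comp_hasDerivAt (0 : ℝ) h5
  convert! h6 using 1
  simp [mul_assoc, add_mul]
  ring

theorem contDiffAt_ringInverse_comp {R : Type} [NormedRing R] [NormedAlgebra ℝ R] [CompleteSpace R]
    [FiniteDimensional ℝ R] {F : Type} [NormedAddCommGroup F] [NormedSpace ℝ F]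
    [FiniteDimensional ℝ F] (τ : R →ₗ[ℝ] ℝ) (L : F →ₗ[ℝ] R) {x : F} (hx : IsUnit (L x)) :
    ContDiffAt ℝ ∞ (fun y => τ (Ring.inverse (L y))) x := by
  obtain ⟨u, hu⟩ := hx
  have h1 : ContDiffAt ℝ ∞ Ring.inverse (L.toContinuousLinearMap x) := by
    have h2 := contDiffAt_ringInverse ℝ (n := ∞) u
    rw [hu] at h2
    exact h2
  exact τ.toContinuousLinearMap.contDiff.contDiffAt.comp x
    (h1.comp x L.toContinuousLinearMap.contDiff.contDiffAt)

theorem hasDerivAt_trace_form {X : Matrix (Fin n) (Fin n) ℝ} (hX : X.PosDef)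
    (ξ η ζ : Matrix (Fin n) (Fin n) ℝ) :
    HasDerivAt (fun t : ℝ => ((X + t • ξ)⁻¹ * η * (X + t • ξ)⁻¹ * ζ).trace)
      (-((X⁻¹ * ξ * X⁻¹ * η * X⁻¹ * ζ).trace + (X⁻¹ * η * X⁻¹ * ξ * X⁻¹ * ζ).trace)) 0 := by
  -- The operator norm serves only to apply the normed algebra version; the statement is about a
  -- real function and does not depend on it.
  let _ : NormedRing (Matrix (Fin n) (Fin n) ℝ) := Matrix.linftyOpNormedRing
  let _ : NormedAlgebra ℝ (Matrix (Fin n) (Fin n) ℝ) := Matrix.linftyOpNormedAlgebra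
  have : CompleteSpace (Matrix (Fin n) (Fin n) ℝ) := FiniteDimensional.complete ℝ _
  obtain ⟨u, hu⟩ := hX.isUnit
  have h := hasDerivAt_ringInverse_form (Matrix.traceLinearMap (Fin n) ℝ ℝ) u ξ η ζ
  rw [Matrix.coe_units_inv, hu] at h
  simp only [Matrix.nonsing_inv_eq_ringInverse] at h ⊢
  exact h

theorem contDiffAt_matTuple_inv {x : MatTuple n K} (hx : x ∈ spdProduct n K) :
    ContDiffAt ℝ ∞ (fun y : MatTuple n K => MatTuple.of fun i => (y.mat i)⁻¹) x := by
  suffices h : ContDiffAt ℝ ∞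
      (fun (y : MatTuple n K) (i : Fin K) (a b : Fin n) => (y.mat i)⁻¹ a b) x from h
  refine contDiffAt_pi.2 fun i => contDiffAt_pi.2 fun a => contDiffAt_pi.2 fun b => ?_
  let _ : NormedRing (Matrix (Fin n) (Fin n) ℝ) := Matrix.linftyOpNormedRing
  let _ : NormedAlgebra ℝ (Matrix (Fin n) (Fin n) ℝ) := Matrix.linftyOpNormedAlgebra
  have : CompleteSpace (Matrix (Fin n) (Fin n) ℝ) := FiniteDimensional.complete ℝ _
  let L : MatTuple n K →ₗ[ℝ] Matrix (Fin n) (Fin n) ℝ :=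
    { toFun := fun y => y.mat i, map_add' := fun _ _ => rfl, map_smul' := fun _ _ => rfl }
  have h := contDiffAt_ringInverse_comp (Matrix.entryLinearMap ℝ ℝ a b) L (x := x) (hx i).isUnit
  have h2 : ∀ y : MatTuple n K, (y.mat i)⁻¹ = Ring.inverse (L y) := fun y =>
    Matrix.nonsing_inv_eq_ringInverse _
  exact h.congr_of_eventuallyEq
    (Filter.Eventually.of_forall fun y => congrFun (congrFun (h2 y) a) b)

/-! ### The connection term as a smooth bilinear map -/

/-- The bilinear map `(ξ, η) ↦ (symm (ξ_i P_i η_i))_i`. -/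
def symProduct (P : MatTuple n K) : MatTuple n K →L[ℝ] MatTuple n K →L[ℝ] MatTuple n K :=
  LinearMap.toContinuousBilinearMap <| LinearMap.mk₂ ℝ
    (fun ξ η => MatTuple.of fun i => symPart (ξ.mat i * P.mat i * η.mat i))
    (fun _ _ _ => by ext1 i; simp [symPart, Matrix.add_mul]; abel)
    (fun _ _ _ => by ext1 i; simp [symPart]; module)
    (fun _ _ _ => by ext1 i; simp [symPart, Matrix.mul_add]; abel)
    (fun _ _ _ => by ext1 i; simp [symPart]; module)

theorem symProduct_apply (P ξ η : MatTuple n K) :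
    symProduct P ξ η = MatTuple.of fun i => symPart (ξ.mat i * P.mat i * η.mat i) := rfl

/-- The term `symm (ξ_i X_i⁻¹ η_i)` of the connection, as a bilinear map. -/
def connectionForm (x : MatTuple n K) : MatTuple n K →L[ℝ] MatTuple n K →L[ℝ] MatTuple n K :=
  symProduct (MatTuple.of fun i => (x.mat i)⁻¹)

theorem connectionForm_apply (x ξ η : MatTuple n K) :
    connectionForm x ξ η = connectionTerm x ξ η := rfl

set_option synthInstance.maxHeartbeats 400000 in
theorem contDiffAt_connectionForm {x : MatTuple n K} (hx : x ∈ spdProduct n K) :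
    ContDiffAt ℝ ∞ connectionForm x := by
  let L : MatTuple n K →L[ℝ] MatTuple n K →L[ℝ] MatTuple n K →L[ℝ] MatTuple n K :=
    LinearMap.toContinuousLinearMap
    { toFun := symProduct
      map_add' := fun P Q => by
        ext ξ η : 2
        rw [add_apply, add_apply]
        simp only [symProduct_apply]
        ext1 i
        simp [symPart, Matrix.mul_add, Matrix.add_mul]
        abel
      map_smul' := fun c P => by
        ext ξ η : 2
        rw [RingHom.id_apply, smul_apply, smul_apply]
        simp only [symProduct_apply]
        ext1 i
        simp [symPart]
        module }
  have hL : ContDiff ℝ ∞ L := ContinuousLinearMap.contDiff _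
  exact hL.contDiffAt.comp x (contDiffAt_matTuple_inv hx)

theorem mat_connectionForm {x ξ η : MatTuple n K} (hx : x ∈ spdProduct n K)
    (hξ : ξ ∈ symTuples n K) (hη : η ∈ symTuples n K) (i : Fin K) :
    (connectionForm x ξ η).mat i = (1 / 2 : ℝ) •
      (ξ.mat i * (x.mat i)⁻¹ * η.mat i + η.mat i * (x.mat i)⁻¹ * ξ.mat i) := by
  rw [connectionForm_apply, connectionTerm, MatTuple.mat_of, symPart, Matrix.transpose_mul,
    Matrix.transpose_mul, Matrix.transpose_nonsing_inv, (isSymm_mat_of_mem hx i).eq, (hξ i).eq,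
    (hη i).eq, Matrix.mul_assoc (η.mat i)]

theorem connectionForm_symm {x ξ η : MatTuple n K} (hx : x ∈ spdProduct n K)
    (hξ : ξ ∈ symTuples n K) (hη : η ∈ symTuples n K) :
    connectionForm x ξ η = connectionForm x η ξ := by
  ext1 i
  rw [mat_connectionForm hx hξ hη, mat_connectionForm hx hη hξ, add_comm]

theorem connectionForm_mem {x ξ η : MatTuple n K} : connectionForm x ξ η ∈ symTuples n K :=
  fun _ => isSymm_symPart _

set_option synthInstance.maxHeartbeats 400000 in
theorem fderiv_affineInvariantForm {x : MatTuple n K} (hx : x ∈ spdProduct n K)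
    (ξ η ζ : MatTuple n K) : fderiv ℝ affineInvariantForm x ξ η ζ = -∑ i,
      (((x.mat i)⁻¹ * ξ.mat i * (x.mat i)⁻¹ * η.mat i * (x.mat i)⁻¹ * ζ.mat i).trace +
        ((x.mat i)⁻¹ * η.mat i * (x.mat i)⁻¹ * ξ.mat i * (x.mat i)⁻¹ * ζ.mat i).trace) := by
  have h1 := ((contDiffAt_affineInvariantForm x hx).differentiableAt (by simp)).hasFDerivAt
  have h2 : HasDerivAt (fun t : ℝ => affineInvariantForm (x + t • ξ) η ζ)
      (fderiv ℝ affineInvariantForm x ξ η ζ) 0 := by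
    have h3 := (h1.hasLineDerivAt ξ)
    have h4 := (h3.clm_apply (hasDerivAt_const (0 : ℝ) η)).clm_apply (hasDerivAt_const (0 : ℝ) ζ)
    simpa using! h4
  have h5 : HasDerivAt (fun t : ℝ => affineInvariantForm (x + t • ξ) η ζ) _ 0 :=
    HasDerivAt.fun_sum (u := Finset.univ) fun i _ =>
      hasDerivAt_trace_form (hx i) (ξ.mat i) (η.mat i) (ζ.mat i)
  rw [h2.unique h5, Finset.sum_neg_distrib]

/-- The property of the connection term that makes the connection metric. -/
theorem fderiv_affineInvariantForm_eq_connectionForm {x ξ η ζ : MatTuple n K}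
    (hx : x ∈ spdProduct n K) (hξ : ξ ∈ symTuples n K) (hη : η ∈ symTuples n K)
    (hζ : ζ ∈ symTuples n K) :
    fderiv ℝ affineInvariantForm x ξ η ζ = -(affineInvariantForm x (connectionForm x ξ η) ζ +
      affineInvariantForm x (connectionForm x ξ ζ) η) := by
  rw [fderiv_affineInvariantForm hx, affineInvariantForm_apply, affineInvariantForm_apply,
    ← Finset.sum_add_distrib]
  congr 1
  refine Finset.sum_congr rfl fun i _ => ?_
  rw [mat_connectionForm hx hξ hη, mat_connectionForm hx hξ hζ]
  set P := (x.mat i)⁻¹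
  set a := ξ.mat i
  set b := η.mat i
  set c := ζ.mat i
  -- Up to cyclic permutation only two of the traces differ.
  have h1 : (P * (c * (P * (a * (P * b))))).trace = (P * (a * (P * (b * (P * c))))).trace := by
    rw [← Matrix.mul_assoc P c, Matrix.trace_mul_comm]; simp only [Matrix.mul_assoc]
  have h2 : (P * (a * (P * (c * (P * b))))).trace = (P * (b * (P * (a * (P * c))))).trace := by
    have : P * (a * (P * (c * (P * b)))) = P * a * P * c * (P * b) := by
      simp only [Matrix.mul_assoc]
    rw [this, Matrix.trace_mul_comm]; simp only [Matrix.mul_assoc]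
  simp only [Matrix.mul_smul, Matrix.smul_mul, Matrix.mul_add, Matrix.add_mul, Matrix.trace_smul,
    Matrix.trace_add, smul_eq_mul, Matrix.mul_assoc, h1, h2]
  ring

end matrix

section matrix
variable {n K : ℕ}

/-! ### The projection onto the tangent space of the simplex -/

theorem simplexTangent_le : simplexTangent n K ≤ symTuples n K := fun _ h => h.1

theorem form_pos_of_mem_simplexTangent {x : MatTuple n K} (hx : x ∈ spdProduct n K) :
    ∀ v ∈ simplexTangent n K, v ≠ 0 → 0 < affineInvariantForm x v v :=
  fun v hv => affineInvariantForm_pos x hx v hv.1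

theorem isTangentProjection_iff {x : MatTuple n K} (hx : x ∈ spdProduct n K) (z p : MatTuple n K) :
    IsTangentProjection x z p ↔
      p = incl (simplexTangent n K) (formProj (simplexTangent n K) (affineInvariantForm x) z) :=
  isMin_iff_eq_formProj (fun v _ w _ => affineInvariantForm_symm x v w)
    (form_pos_of_mem_simplexTangent hx) z p

theorem tangentProjection_eq {x : MatTuple n K} (hx : x ∈ spdProduct n K) (z : MatTuple n K) :
    tangentProjection x z =
      incl (simplexTangent n K) (formProj (simplexTangent n K) (affineInvariantForm x) z) :=
  (isTangentProjection_iff hx z _).1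
    (Classical.epsilon_spec (p := IsTangentProjection x z)
      ⟨_, (isTangentProjection_iff hx z _).2 rfl⟩)

/-- Pair the sum with `Λ`: the traces `tr (X_i Λ X_i Λ)` are nonnegative, and zero only for `Λ = 0`. -/
theorem eq_zero_of_sum_mul_mul_eq_zero {x : MatTuple n K} (hx : x ∈ matrixSimplex n K)
    {Λ : Matrix (Fin n) (Fin n) ℝ} (hΛ : Λ.IsSymm) (h : ∑ i, x.mat i * Λ * x.mat i = 0) :
    Λ = 0 := by
  rcases isEmpty_or_nonempty (Fin K) with hK | ⟨⟨j⟩⟩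
  -- The empty sum is `1` only for matrices of size zero.
  · have h1 := hx.2
    rw [Finset.univ_eq_empty, Finset.sum_empty] at h1
    rw [← one_mul Λ, ← h1, zero_mul]
  have h1 : ∀ i, 0 ≤ (x.mat i * Λ * x.mat i * Λ).trace ∧
      ((x.mat i * Λ * x.mat i * Λ).trace = 0 → Λ = 0) := by
    intro i
    have h2 := trace_form_nonneg (hx.1 i).inv hΛ
    rwa [Matrix.nonsing_inv_nonsing_inv _
      ((Matrix.isUnit_iff_isUnit_det _).1 (hx.1 i).isUnit)] at h2
  have h3 : ∑ i, (x.mat i * Λ * x.mat i * Λ).trace = 0 := by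
    rw [← Matrix.trace_sum, ← Finset.sum_mul, h, zero_mul, Matrix.trace_zero]
  exact (h1 j).2 ((Finset.sum_eq_zero_iff_of_nonneg fun i _ => (h1 i).1).1 h3 j (Finset.mem_univ j))

theorem isSymm_conj {X Λ : Matrix (Fin n) (Fin n) ℝ} (hX : X.IsSymm) (hΛ : Λ.IsSymm) :
    (X * Λ * X).IsSymm := by
  rw [Matrix.IsSymm, Matrix.transpose_mul, Matrix.transpose_mul, hX.eq, hΛ.eq, Matrix.mul_assoc]

theorem isSymm_sum {ι : Type*} {t : Finset ι} {A : ι → Matrix (Fin n) (Fin n) ℝ}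
    (hA : ∀ i, (A i).IsSymm) : (∑ i ∈ t, A i).IsSymm := by
  rw [Matrix.IsSymm, Matrix.transpose_sum]
  exact Finset.sum_congr rfl fun i _ => hA i

theorem existsUnique_isMultiplier {x z : MatTuple n K} (hx : x ∈ matrixSimplex n K)
    (hz : z ∈ symTuples n K) : ∃! Λ, IsMultiplier x z Λ := by
  let S : Submodule ℝ (Matrix (Fin n) (Fin n) ℝ) :=
    { carrier := {A | A.IsSymm}
      zero_mem' := Matrix.isSymm_zero
      add_mem' := fun ha hb => ha.add hb
      smul_mem' := fun c _ ha => ha.smul c }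
  let T : S →ₗ[ℝ] S :=
    { toFun := fun Λ => ⟨∑ i, x.mat i * Λ * x.mat i,
        isSymm_sum fun i => isSymm_conj (isSymm_mat_of_mem hx.1 i) Λ.2⟩
      map_add' := fun A C => Subtype.ext (by
        simp [Matrix.mul_add, Matrix.add_mul, Finset.sum_add_distrib])
      map_smul' := fun c A => Subtype.ext (by simp [Finset.smul_sum]) }
  have hinj : Function.Injective T := by
    rw [← LinearMap.ker_eq_bot, LinearMap.ker_eq_bot']
    intro A hA
    exact Subtype.ext (eq_zero_of_sum_mul_mul_eq_zero hx A.2 (congrArg Subtype.val hA))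
  obtain ⟨Λ, hΛ⟩ := (LinearMap.injective_iff_surjective.1 hinj)
    ⟨-∑ i, z.mat i, (isSymm_sum fun i => hz i).neg⟩
  refine ⟨Λ, ⟨Λ.2, congrArg Subtype.val hΛ⟩, fun A hA => ?_⟩
  have h1 : T ⟨A, hA.1⟩ = T Λ := by
    rw [hΛ]; exact Subtype.ext hA.2
  exact congrArg Subtype.val (hinj h1)

theorem tangentProjection_eq_of_isMultiplier {x z : MatTuple n K} (hx : x ∈ matrixSimplex n K)
    (hz : z ∈ symTuples n K) {Λ : Matrix (Fin n) (Fin n) ℝ} (hΛ : IsMultiplier x z Λ) :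
    tangentProjection x z = MatTuple.of fun i => z.mat i + x.mat i * Λ * x.mat i := by
  rw [tangentProjection_eq hx.1]
  refine incl_formProj_eq (form_pos_of_mem_simplexTangent hx.1) ⟨fun i => ?_, ?_⟩ fun w hw => ?_
  · exact (hz i).add (isSymm_conj (isSymm_mat_of_mem hx.1 i) hΛ.1)
  · simp only [MatTuple.mat_of]
    rw [Finset.sum_add_distrib, hΛ.2, add_neg_cancel]
  · have h1 : ∀ i, (x.mat i)⁻¹ * (x.mat i * Λ * x.mat i) * (x.mat i)⁻¹ = Λ := by
      intro i
      have hu := (Matrix.isUnit_iff_isUnit_det _).1 (hx.1 i).isUnit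
      rw [Matrix.mul_assoc (x.mat i), Matrix.nonsing_inv_mul_cancel_left _ _ hu,
        Matrix.mul_nonsing_inv_cancel_right _ _ hu]
    simp only [affineInvariantForm_apply, MatTuple.mat_of, Matrix.mul_add, Matrix.add_mul, h1,
      Matrix.trace_add, Finset.sum_add_distrib]
    rw [← Matrix.trace_sum _ (fun i => Λ * w.mat i), ← Finset.mul_sum, hw.2, mul_zero,
      Matrix.trace_zero, add_zero]

/-! ### Euclidean gradients -/

/-- The symmetrization of a tuple of matrices. -/
def symmetrize : MatTuple n K →L[ℝ] MatTuple n K :=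
  LinearMap.toContinuousLinearMap
    { toFun := fun y => MatTuple.of fun i => symPart (y.mat i)
      map_add' := fun y z => by ext1 i; simp [symPart]; abel
      map_smul' := fun c y => by ext1 i; simp [symPart]; module }

theorem symmetrize_of_mem {y : MatTuple n K} (hy : y ∈ symTuples n K) : symmetrize y = y := by
  ext1 i
  exact symPart_of_isSymm (hy i)

theorem mem_symTuples_of_mem_spdProduct {y : MatTuple n K} (hy : y ∈ spdProduct n K) :
    y ∈ symTuples n K := isSymm_mat_of_mem hy

/-- The function `f` is only smooth on a set without interior in the space of all tuples; composed
with the symmetrization it becomes smooth on a neighbourhood. -/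
theorem contDiffAt_comp_symmetrize {f : MatTuple n K → ℝ} (hf : ContDiffOn ℝ ∞ f (spdProduct n K))
    {x : MatTuple n K} (hx : x ∈ spdProduct n K) :
    ContDiffAt ℝ ∞ (fun y => f (symmetrize y)) x := by
  have hopen : IsOpen (symmetrize ⁻¹' spdProduct n K : Set (MatTuple n K)) := by
    have : (symmetrize ⁻¹' spdProduct n K : Set (MatTuple n K)) =
        ⋂ i, {y | ((symmetrize y).mat i).PosDef} := by
      ext y; simp [spdProduct]
    rw [this]
    refine isOpen_iInter_of_finite fun i => isOpen_posDef_symm _ ?_ fun y => isSymm_symPart _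
    exact continuous_pi fun a => continuous_pi fun b =>
      (MatTuple.entry i a b).continuous.comp symmetrize.continuous
  have h1 := hf.comp symmetrize.contDiff.contDiffOn (Set.Subset.refl _)
  refine h1.contDiffAt (hopen.mem_nhds ?_)
  rw [Set.mem_preimage, symmetrize_of_mem (mem_symTuples_of_mem_spdProduct hx)]
  exact hx

theorem comp_symmetrize_update (f : MatTuple n K → ℝ) {x : MatTuple n K} (hx : x ∈ symTuples n K)
    (i : Fin K) {H : Matrix (Fin n) (Fin n) ℝ} (hH : H.IsSymm) (t : ℝ) :
    f (symmetrize (MatTuple.of (Function.update x.mat i (x.mat i + t • H)))) =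
      f (MatTuple.of (Function.update x.mat i (x.mat i + t • H))) := by
  rw [symmetrize_of_mem]
  intro j
  rcases eq_or_ne j i with rfl | hj
  · simpa using (hx j).add (hH.smul t)
  · simpa [hj] using hx j

theorem isEuclideanGradient_comp_symmetrize_iff (f : MatTuple n K → ℝ) {x : MatTuple n K}
    (hx : x ∈ symTuples n K) (G : MatTuple n K) :
    IsEuclideanGradient (fun y => f (symmetrize y)) x G ↔ IsEuclideanGradient f x G := by
  refine forall_congr' fun i => forall_congr' fun H => forall_congr' fun hH => ?_
  simp only [comp_symmetrize_update f hx i hH]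

theorem exists_isEuclideanGradient {f : MatTuple n K → ℝ} {x : MatTuple n K}
    (hf : DifferentiableAt ℝ f x) : ∃ G, IsEuclideanGradient f x G :=
  ⟨MatTuple.of fun i => Matrix.of fun a b =>
    fderiv ℝ f x (MatTuple.of (Pi.single i (Matrix.single a b (1 : ℝ)))),
    fun i => isPartialGradient_of_differentiableAt f x hf i⟩

theorem sum_single_mat (w : MatTuple n K) : ∑ i, MatTuple.of (Pi.single i (w.mat i)) = w :=
  Finset.univ_sum_single (M := fun _ : Fin K => Matrix (Fin n) (Fin n) ℝ) w

theorem fderiv_eq_of_isEuclideanGradient {f : MatTuple n K → ℝ} {x G : MatTuple n K}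
    (hf : DifferentiableAt ℝ f x) (hG : IsEuclideanGradient f x G) {w : MatTuple n K}
    (hw : w ∈ symTuples n K) : fderiv ℝ f x w = ∑ i, ((G.mat i)ᵀ * w.mat i).trace := by
  conv_lhs => rw [← sum_single_mat w, map_sum]
  refine Finset.sum_congr rfl fun i _ => ?_
  have h1 := hf.hasFDerivAt.hasLineDerivAt (MatTuple.of (Pi.single i (w.mat i)))
  have h2 : ∀ t : ℝ, MatTuple.of (Function.update x.mat i (x.mat i + t • w.mat i)) =
      x + t • MatTuple.of (Pi.single i (w.mat i)) := by
    intro t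
    ext1 j
    by_cases hj : j = i
    · subst hj; simp
    · simp [hj]
  have h3 := hG i (w.mat i) (hw i)
  simp only [h2] at h3
  exact HasDerivAt.unique h1 h3

theorem form_scaledGradient {x G w : MatTuple n K} (hx : x ∈ spdProduct n K)
    (hw : w ∈ symTuples n K) : affineInvariantForm x (scaledGradient x G) w =
      ∑ i, ((G.mat i)ᵀ * w.mat i).trace := by
  rw [affineInvariantForm_apply]
  refine Finset.sum_congr rfl fun i _ => ?_
  have hu := (Matrix.isUnit_iff_isUnit_det _).1 (hx i).isUnit
  rw [scaledGradient, MatTuple.mat_of, Matrix.mul_assoc (x.mat i),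
    Matrix.nonsing_inv_mul_cancel_left _ _ hu, Matrix.mul_nonsing_inv_cancel_right _ _ hu,
    trace_symPart_mul (hw i)]

theorem scaledGradient_mem {x : MatTuple n K} (hx : x ∈ spdProduct n K) (G : MatTuple n K) :
    scaledGradient x G ∈ symTuples n K :=
  fun i => isSymm_conj (isSymm_mat_of_mem hx i) (isSymm_symPart _)

theorem comp_symmetrize_spd (f : MatTuple n K → ℝ) :
    (fun y : spdProduct n K => f y) = fun y : spdProduct n K => f (symmetrize y) :=
  funext fun y => congrArg f (symmetrize_of_mem (mem_symTuples_of_mem_spdProduct y.2)).symm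

theorem comp_symmetrize_simplex (f : MatTuple n K → ℝ) :
    (fun y : matrixSimplex n K => f y) = fun y : matrixSimplex n K => f (symmetrize y) :=
  funext fun y => congrArg f (symmetrize_of_mem (mem_symTuples_of_mem_spdProduct y.2.1)).symm

theorem emb_gradient_spd {f : MatTuple n K → ℝ} (hf : ContDiffOn ℝ ∞ f (spdProduct n K))
    (x : spdProduct n K) {G : MatTuple n K} (hG : IsEuclideanGradient f x G) :
    emb x (riemannianGradient (spdMetric n K) (fun y => f y) x) = scaledGradient x G := by
  rw [comp_symmetrize_spd]
  have hd := (contDiffAt_comp_symmetrize hf x.2).differentiableAt (by simp)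
  rw [← isEuclideanGradient_comp_symmetrize_iff f (mem_symTuples_of_mem_spdProduct x.2)] at hG
  refine eq_of_form_eq (affineInvariantForm_pos x x.2) (emb_mem x _) (scaledGradient_mem x.2 G)
    fun w hw => ?_
  rw [form_scaledGradient x.2 hw, ← fderiv_eq_of_isEuclideanGradient hd hG hw]
  exact form_gradient_apply hd hw

theorem emb_gradient_simplex {f : MatTuple n K → ℝ} (hf : ContDiffOn ℝ ∞ f (spdProduct n K))
    (x : matrixSimplex n K) {G : MatTuple n K} (hG : IsEuclideanGradient f x G) :
    emb x (riemannianGradient (simplexMetric n K) (fun y => f y) x) =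
      tangentProjection x (scaledGradient x G) := by
  rw [comp_symmetrize_simplex]
  have hd := (contDiffAt_comp_symmetrize hf x.2.1).differentiableAt (by simp)
  rw [← isEuclideanGradient_comp_symmetrize_iff f (mem_symTuples_of_mem_spdProduct x.2.1)] at hG
  rw [tangentProjection_eq x.2.1]
  refine (incl_formProj_eq (form_pos_of_mem_simplexTangent x.2.1) (emb_mem x _) fun w hw => ?_).symm
  rw [form_scaledGradient x.2.1 hw.1, ← fderiv_eq_of_isEuclideanGradient hd hG hw.1]
  exact form_gradient_apply hd hw

/-! ### The Levi-Civita connections and the Hessian -/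

theorem exists_isLeviCivita_spd : ∃ cov, IsLeviCivita (spdMetric n K) cov ∧
    CovariantDerivative.ContMDiffCovariantDerivative cov ∞ :=
  ⟨projConnection (s := spdProduct n K) (V := symTuples n K) affineInvariantForm connectionForm,
    isLeviCivita_projConnection (s := spdProduct n K) (V := symTuples n K)
      (B := affineInvariantForm) (G := connectionForm) _ _ _
      (fun _ hx _ hξ _ hη => connectionForm_symm hx hξ hη)
      (fun _ hx _ hξ _ hη _ hζ => fderiv_affineInvariantForm_eq_connectionForm hx hξ hη hζ),
    contMDiff_projConnection affineInvariantForm_pos contDiffAt_affineInvariantForm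
      fun _ hx => contDiffAt_connectionForm hx⟩

theorem exists_isLeviCivita_simplex : ∃ cov, IsLeviCivita (simplexMetric n K) cov ∧
    CovariantDerivative.ContMDiffCovariantDerivative cov ∞ :=
  ⟨projConnection (s := matrixSimplex n K) (V := simplexTangent n K)
      affineInvariantForm connectionForm,
    isLeviCivita_projConnection (s := matrixSimplex n K) (V := simplexTangent n K)
      (B := affineInvariantForm) (G := connectionForm) _ _ _
      (fun _ hx _ hξ _ hη => connectionForm_symm hx.1 hξ.1 hη.1)
      (fun _ hx _ hξ _ hη _ hζ =>
        fderiv_affineInvariantForm_eq_connectionForm hx.1 hξ.1 hη.1 hζ.1),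
    contMDiff_projConnection (fun _ hx => form_pos_of_mem_simplexTangent hx.1)
      (fun x hx => contDiffAt_affineInvariantForm x hx.1)
      fun _ hx => contDiffAt_connectionForm hx.1⟩

theorem emb_leviCivita_spd
    {cov : CovariantDerivative 𝓘(ℝ, Direction (symTuples n K)) (Direction (symTuples n K))
      (fun x : spdProduct n K => TangentSpace 𝓘(ℝ, Direction (symTuples n K)) x)}
    (h : IsLeviCivita (spdMetric n K) cov) {x : spdProduct n K}
    {η : VectorField (spdProduct n K) (symTuples n K)} (hη : DiffFieldAt η x)
    (ξ : TangentSpace 𝓘(ℝ, Direction (symTuples n K)) x) :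
    emb x (cov η x ξ) = dirDeriv η x ξ - connectionTerm x (emb x ξ) (emb x (η x)) := by
  refine (emb_leviCivita_apply (s := spdProduct n K) (V := symTuples n K)
    (B := affineInvariantForm) (G := connectionForm)
    (fun _ hx _ hξ _ hη => connectionForm_symm hx hξ hη)
    (fun _ hx _ hξ _ hη _ hζ => fderiv_affineInvariantForm_eq_connectionForm hx hξ hη hζ)
    h hη ξ).trans ?_
  have h1 : connectionForm (x : MatTuple n K) (emb x ξ) (emb x (η x)) ∈ symTuples n K :=
    connectionForm_mem
  have h2 := (symTuples n K).sub_mem (dirDeriv_mem η hη ξ) h1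
  exact incl_formProj_of_mem (affineInvariantForm_pos (x : MatTuple n K) x.2) h2

theorem emb_leviCivita_simplex
    {cov : CovariantDerivative 𝓘(ℝ, Direction (simplexTangent n K)) (Direction (simplexTangent n K))
      (fun x : matrixSimplex n K => TangentSpace 𝓘(ℝ, Direction (simplexTangent n K)) x)}
    (h : IsLeviCivita (simplexMetric n K) cov) {x : matrixSimplex n K}
    {η : VectorField (matrixSimplex n K) (simplexTangent n K)} (hη : DiffFieldAt η x)
    (ξ : TangentSpace 𝓘(ℝ, Direction (simplexTangent n K)) x) :
    emb x (cov η x ξ) = tangentProjection x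
      (dirDeriv η x ξ - connectionTerm x (emb x ξ) (emb x (η x))) := by
  rw [tangentProjection_eq x.2.1]
  exact emb_leviCivita_apply (s := matrixSimplex n K) (V := simplexTangent n K)
    (B := affineInvariantForm) (G := connectionForm)
    (fun _ hx _ hξ _ hη => connectionForm_symm hx.1 hξ.1 hη.1)
    (fun _ hx _ hξ _ hη _ hζ =>
      fderiv_affineInvariantForm_eq_connectionForm hx.1 hξ.1 hη.1 hζ.1) h hη ξ

theorem diffFieldAt_gradient_simplex {f : MatTuple n K → ℝ}
    (hf : ContDiffOn ℝ ∞ f (spdProduct n K)) (x : matrixSimplex n K) :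
    DiffFieldAt (riemannianGradient (simplexMetric n K) (fun y => f y)) x := by
  rw [comp_symmetrize_simplex]
  exact diffFieldAt_gradient (F := fun y => f (symmetrize y))
    (fun y hy => contDiffAt_comp_symmetrize hf hy.1) x

end matrix

end

theorem mainTheorem4 (n K : ℕ) :
    -- The projection `Π_x` is well defined, with the expression `Z_i + X_i Λ X_i`.
    (∀ (x : matrixSimplex n K) (z : MatTuple n K),
      (∀ p : MatTuple n K, IsTangentProjection x z p ↔ p = tangentProjection x z) ∧
      (z ∈ symTuples n K →
        (∃! Λ, IsMultiplier x z Λ) ∧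
        ∀ Λ, IsMultiplier x z Λ →
          tangentProjection x z =
            MatTuple.of fun i => z.mat i + x.1.mat i * Λ * x.1.mat i)) ∧
    -- The gradient, on the product of the SPD manifolds and on the matrix simplex.
    (∀ f : MatTuple n K → ℝ, ContDiffOn ℝ ∞ f (spdProduct n K) →
      (∀ x : spdProduct n K, ∃ G : MatTuple n K, IsEuclideanGradient f x G) ∧
      (∀ (x : spdProduct n K) (G : MatTuple n K), IsEuclideanGradient f x G →
        emb x (riemannianGradient (spdMetric n K) (fun y => f y) x) = scaledGradient x G) ∧
      (∀ (x : matrixSimplex n K) (G : MatTuple n K), IsEuclideanGradient f x G →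
        emb x (riemannianGradient (simplexMetric n K) (fun y => f y) x) =
          tangentProjection x (scaledGradient x G))) ∧
    -- The Levi-Civita connections exist and are smooth.
    (∃ cov, IsLeviCivita (spdMetric n K) cov ∧ CovariantDerivative.ContMDiffCovariantDerivative cov ∞) ∧
    (∃ cov, IsLeviCivita (simplexMetric n K) cov ∧ CovariantDerivative.ContMDiffCovariantDerivative cov ∞) ∧
    -- The Levi-Civita connection of the product of the SPD manifolds.
    (∀ covS, IsLeviCivita (spdMetric n K) covS →
      ∀ (x : spdProduct n K) (η : VectorField (spdProduct n K) (symTuples n K)),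
        DiffFieldAt η x →
        ∀ ξ, emb x (covS η x ξ) = dirDeriv η x ξ - connectionTerm x (emb x ξ) (emb x (η x))) ∧
    -- The Levi-Civita connection of the matrix simplex, and the Hessian.
    (∀ cov, IsLeviCivita (simplexMetric n K) cov →
      (∀ (x : matrixSimplex n K) (η : VectorField (matrixSimplex n K) (simplexTangent n K)),
        DiffFieldAt η x →
        ∀ ξ,
          emb x (cov η x ξ) = tangentProjection x
            (dirDeriv η x ξ - connectionTerm x (emb x ξ) (emb x (η x))) ∧
          ∀ covS, IsLeviCivita (spdMetric n K) covS →
            ∀ (ηS : VectorField (spdProduct n K) (symTuples n K))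
              (ξS : TangentSpace 𝓘(ℝ, Direction (symTuples n K)) (simplexToSpd x)),
              DiffFieldAt ηS (simplexToSpd x) →
              (∀ y : matrixSimplex n K, emb (simplexToSpd y) (ηS (simplexToSpd y)) = emb y (η y)) →
              emb (simplexToSpd x) ξS = emb x ξ →
              emb x (cov η x ξ) = tangentProjection x
                (emb (simplexToSpd x) (covS ηS (simplexToSpd x) ξS))) ∧
      (∀ f : MatTuple n K → ℝ, ContDiffOn ℝ ∞ f (spdProduct n K) → ∀ x : matrixSimplex n K,
        (∃! Hs, IsHessianAt (simplexMetric n K) cov (fun y => f y) x Hs) ∧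
        ∀ Hs, IsHessianAt (simplexMetric n K) cov (fun y => f y) x Hs →
          ∀ ξ,
            Hs ξ = cov (riemannianGradient (simplexMetric n K) (fun y => f y)) x ξ ∧
            emb x (Hs ξ) = tangentProjection x
              (dirDeriv (riemannianGradient (simplexMetric n K) (fun y => f y)) x ξ -
                connectionTerm x (emb x ξ)
                  (emb x (riemannianGradient (simplexMetric n K) (fun y => f y) x))))) := by
  refine ⟨fun x z => ⟨fun p => ?_, fun hz => ⟨existsUnique_isMultiplier x.2 hz, fun Λ hΛ =>
    tangentProjection_eq_of_isMultiplier x.2 hz hΛ⟩⟩, fun f hf => ⟨fun x => ?_,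
    fun x G hG => emb_gradient_spd hf x hG, fun x G hG => emb_gradient_simplex hf x hG⟩,
    exists_isLeviCivita_spd, exists_isLeviCivita_simplex,
    fun covS hcovS x η hη ξ => emb_leviCivita_spd hcovS hη ξ, fun cov hcov => ⟨?_, ?_⟩⟩
  · rw [isTangentProjection_iff x.2.1, tangentProjection_eq x.2.1]
  · obtain ⟨G, hG⟩ := exists_isEuclideanGradient
      ((contDiffAt_comp_symmetrize hf x.2).differentiableAt (by simp))
    exact ⟨G, (isEuclideanGradient_comp_symmetrize_iff f
      (mem_symTuples_of_mem_spdProduct x.2) G).1 hG⟩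
  · intro x η hη ξ
    refine ⟨emb_leviCivita_simplex hcov hη ξ, fun covS hcovS ηS ξS hηS hext hξ => ?_⟩
    rw [emb_leviCivita_simplex hcov hη ξ, emb_leviCivita_spd hcovS hηS ξS,
      dirDeriv_eq_of_extends simplexTangent_le simplexToSpd (fun _ => rfl) hηS hext hξ, hξ, hext]
    rfl
  · intro f hf x
    have hd := diffFieldAt_gradient_simplex hf x
    have hH := isHessianAt_cov_gradient hcov hd
    refine ⟨⟨_, hH, fun A hA => isHessianAt_unique hA hH⟩, fun A hA ξ => ?_⟩
    rw [isHessianAt_unique hA hH]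
    exact ⟨rfl, emb_leviCivita_simplex hcov hd ξ⟩
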